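/- \textbf{Signature.} Fix a signature $\Sigma$ consisting of the integers $\mathbb Z$ with $0,1,+,-,=,<,\equiv_n$ and finitely many integer parameters, one of which is $\mathtt N$; a sort $\mathtt{Proc}$ with equality only; and finitely many enumerated sorts $\mathtt{Data}$, each with finitely many (at least one) distinct named values. A model $\mathcal M$ of $\Sigma$ interprets $\mathtt{Proc}$ as a finite set with exactly $\mathtt N$ elements and the parameters as integers, everything else having its standard meaning. (The result holds both if $\mathtt{Proc}$ may be empty and if it is required to be nonempty.) The arithmetic subsignature $\Sigma_0$ keeps only $\mathbb Z$ and the parameters; its models are the restrictions of models of $\Sigma$. A $\Sigma_0$-formula is a first-order formula of linear (Presburger) arithmetic. \textbf{Specifications.} Let $\mathbf v=\mathbf v_0\mathbf v_1$, where $\mathbf v_0$ is a finite tuple of integer variables and $\mathbf v_1$ a finite tuple of arithmetic array-ids ($\mathtt{Proc}\to\mathbb Z$) and enumerated array-ids ($\mathtt{Proc}\to\mathtt{Data}$), and let $\mathbf v'$ be a renamed copy of $\mathbf v$. Let $i$ be a $\mathtt{Proc}$-variable. A $\mathtt{Data}$-atom in $i$ is $a(i)=c$ or $a(i)=b(i)$,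 with $a,b$ enumerated array-ids and $c$ a value; a $\mathtt{Data}$-formula is a Boolean combination of $\mathtt{Data}$-atoms; an extended arithmetic atom in $i$ is a formula built with $+,-$ and $=,<,\le,\equiv_n$ from parameters, numerals, integer variables, terms $a(i)$ with $a$ an arithmetic array-id, and terms $\sharp\{k\mid\psi(k)\}$ with $\psi(k)$ a $\mathtt{Data}$-formula in the single $\mathtt{Proc}$-variable $k$. A system specification $\mathcal S=(\Sigma,\mathbf v,\Phi,\iota,\tau,AP)$ consists of an invariant formula $\Phi(\mathbf v)$, an initial formula $\iota(\mathbf v)$, a transition formula $\tau(\mathbf v,\mathbf v')$ and a set $AP$ of quantifier-free $\Sigma_0$-formulas in $\mathbf v_0$, such that $\iota(\mathbf v)\models_\Sigma\Phi(\mathbf v)$ and $\Phi(\mathbf v)\wedge\tau(\mathbf v,\mathbf v')\models_\Sigma\Phi(\mathbf v')$. Its transition system $T^{\mathcal S}$ has as states the pairs of a model and an interpretation of $\mathbf v$ satisfying $\Phi$; initial states are those satisfying $\iota$; transitions are the pairs of states over the same model satisfying $\tau$; each state is labelled with the formulas of $AP$ true in it. \textbf{Counter abstractions.} A simulation of a transition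 system $T$ by a transition system $T'$ is a relation $\rho\subseteq W\times W'$ between their sets of states such that every $w\in W$ is related to some $w'\in W'$; whenever $w\rho w'$, the labels of $w$ and $w'$ coincide, $w'$ is initial if $w$ is, and for every transition $w\to u$ of $T$ there is a transition $w'\to u'$ of $T'$ with $u\rho u'$. Write $T\le T'$ if $W\subseteq W'$ and the inclusion is a simulation. A counter abstraction of $\mathcal S$ is a system specification $\mathcal S_0=(\Sigma_0,\mathbf v_0,\Phi_0,\iota_0,\tau_0,AP)$ with $\Sigma_0$-formulas $\Phi_0(\mathbf v_0),\iota_0(\mathbf v_0),\tau_0(\mathbf v_0,\mathbf v_0')$ (so $\iota_0\models_{\Sigma_0}\Phi_0$ and $\Phi_0(\mathbf v_0)\wedge\tau_0\models_{\Sigma_0}\Phi_0(\mathbf v'_0)$) such that $\Phi\models_\Sigma\Phi_0$, $\iota\models_\Sigma\iota_0$ and $\Phi\wedge\tau\models_\Sigma\tau_0$; its transition system $T^{\mathcal S_0}$ is formed in the same way from the models of $\Sigma_0$. It is a strongest one if $T^{\mathcal S_0}\le T^{\mathcal S_0'}$ for every counter abstraction $\mathcal S_0'$ of $\mathcal S$.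 \textbf{Theorem.} Let $\mathcal S=(\Sigma,\mathbf v_0\mathbf v_1,\Phi,\iota,\tau,AP)$ be a system specification in which each of $\Phi,\iota,\tau$ is a finite disjunction of formulas $\forall i\,\phi(i)$, where $\phi(i)$ is a Boolean combination of $\mathtt{Data}$-atoms and extended arithmetic atoms in the single $\mathtt{Proc}$-variable $i$. Then $\mathcal S$ has a strongest counter abstraction $\mathcal S_0=(\Sigma_0,\mathbf v_0,\Phi_0,\iota_0,\tau_0,AP)$, and $(\Phi_0,\iota_0,\tau_0)$ is computable from $\Sigma,\mathbf v,\Phi,\iota,\tau$ by one algorithm for all signatures and specifications. Moreover, projection onto the values of the parameters and of $\mathbf v_0$ is a simulation of $T^{\mathcal S}$ by $T^{\mathcal S_0}$, and the following equivalences are valid in all models of $\Sigma$: $\Phi_0\leftrightarrow\exists\mathbf v_1\,\Phi$, $\iota_0\leftrightarrow\exists\mathbf v_1\,\iota$, and $\tau_0\leftrightarrow\exists\mathbf v_1\exists\mathbf v_1'(\Phi\wedge\tau)$. -/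

import Mathlib

namespace CounterAbs

universe u v w

/-! ## Transition systems and simulations -/

/-- A transition system whose states are taken from `α`, with atomic propositions `P`:
states `W`, initial states `W₀`, transitions `R` and labelling `V` (only its values on `W`
matter). -/
structure TransitionSystem (α : Type u) (P : Type v) where
  W : Set α
  W₀ : Set α
  R : α → α → Prop
  V : α → Set P
  init_sub : W₀ ⊆ W
  rel_sub : ∀ w w', R w w' → w ∈ W ∧ w' ∈ W

/-- `ρ ⊆ W × W'` is a simulation of `T` by `T'`. -/
structure IsSimulation {α : Type u} {β : Type v} {P : Type w}
    (T : TransitionSystem α P) (T' : TransitionSystem β P) (ρ : α → β → Prop) : Prop where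
  mem : ∀ w w', ρ w w' → w ∈ T.W ∧ w' ∈ T'.W
  total : ∀ w ∈ T.W, ∃ w' ∈ T'.W, ρ w w'
  init : ∀ w w', ρ w w' → w ∈ T.W₀ → w' ∈ T'.W₀
  step : ∀ w w' u, ρ w w' → T.R w u → ∃ u' ∈ T'.W, T'.R w' u' ∧ ρ u u'
  label : ∀ w w', ρ w w' → T.V w = T'.V w'

/-- `T ≤ T'`: the states of `T` are states of `T'` and the inclusion is a simulation. -/
def TransitionSystem.Le {α : Type u} {P : Type v} (T T' : TransitionSystem α P) : Prop :=
  T.W ⊆ T'.W ∧ IsSimulation T T' (fun w w' => w ∈ T.W ∧ w' = w)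

/-! ## The signature and its models -/

/-- The data of a signature: `numPar` arithmetic parameters, one of which is `N`, and `numData`
enumerated sorts, where the `d`-th sort has the `top d + 1` distinct values `0, …, top d`.
The flag `emptyProc` says whether `Proc` may be interpreted as the empty set; both conventions
are covered. -/
structure Sig where
  numPar : ℕ
  N : Fin numPar
  numData : ℕ
  top : Fin numData → ℕ
  emptyProc : Bool

/-- The set of values of an enumerated sort. -/
abbrev Sig.Val (σ : Sig) (d : Fin σ.numData) : Type := Fin (σ.top d + 1)

/-- A model of the signature: a finite set `Proc` (nonempty, unless the empty set is allowed)
and values of the parameters, where the parameter `N` denotes the cardinality of `Proc`. All other sorts and symbols have their fixed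
standard meaning. -/
structure Model (σ : Sig) where
  Proc : Type
  finite : Finite Proc
  nonempty : σ.emptyProc = false → Nonempty Proc
  par : Fin σ.numPar → ℤ
  card_eq : par σ.N = (Nat.card Proc : ℤ)

/-- A model of the arithmetic subsignature: the restriction of a model to the parameters. -/
def ArithModel (σ : Sig) : Type := {p : Fin σ.numPar → ℤ // ∃ M : Model σ, M.par = p}

/-- The restriction of a model to the arithmetic subsignature. -/
def Model.restrict {σ : Sig} (M : Model σ) : ArithModel σ := ⟨M.par, M, rfl⟩

/-! ## Boolean combinations, linear terms and arithmetic atoms -/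

/-- Boolean combinations of elements of `α`. -/
inductive BoolComb (α : Type) : Type
  | tt : BoolComb α
  | ff : BoolComb α
  | atom (a : α) : BoolComb α
  | neg (φ : BoolComb α) : BoolComb α
  | and (φ ψ : BoolComb α) : BoolComb α
  | or (φ ψ : BoolComb α) : BoolComb α

/-- Truth of a Boolean combination, given the truth values of the atoms. -/
def BoolComb.Holds {α : Type} (val : α → Prop) : BoolComb α → Prop
  | tt => True
  | ff => False
  | atom a => val a
  | neg φ => ¬ φ.Holds val
  | and φ ψ => φ.Holds val ∧ ψ.Holds val
  | or φ ψ => φ.Holds val ∨ ψ.Holds val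

/-- Terms obtained from numerals and the basic terms in `L` by `+` and `-`. -/
inductive LinTerm (L : Type) : Type
  | num (c : ℤ) : LinTerm L
  | basic (l : L) : LinTerm L
  | add (s t : LinTerm L) : LinTerm L
  | sub (s t : LinTerm L) : LinTerm L

/-- The value of a term. -/
def LinTerm.eval {L : Type} (val : L → ℤ) : LinTerm L → ℤ
  | num c => c
  | basic l => val l
  | add s t => s.eval val + t.eval val
  | sub s t => s.eval val - t.eval val

/-- Arithmetic atoms `s = t`, `s < t`, `s ≤ t`, `s ≡ₙ t`. -/
inductive ArithAtom (L : Type) : Type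
  | eq (s t : LinTerm L) : ArithAtom L
  | lt (s t : LinTerm L) : ArithAtom L
  | le (s t : LinTerm L) : ArithAtom L
  | modEq (n : ℕ) (s t : LinTerm L) : ArithAtom L

/-- Truth of an arithmetic atom. -/
def ArithAtom.Holds {L : Type} (val : L → ℤ) : ArithAtom L → Prop
  | eq s t => s.eval val = t.eval val
  | lt s t => s.eval val < t.eval val
  | le s t => s.eval val ≤ t.eval val
  | modEq n s t => s.eval val ≡ t.eval val [ZMOD n]

/-! ## Formulas with array-ids

`X`, `A`, `B` are the sets of integer variables, arithmetic array-ids and enumerated array-ids,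
and `srt b` is the enumerated sort in which the array-id `b` takes its values. -/

/-- Data-atoms in one `Proc`-variable `i`: `a(i) = c` for a value `c`, and `a(i) = b(i)`. -/
inductive DataAtom (σ : Sig) {B : Type} (srt : B → Fin σ.numData) : Type
  | eqVal (a : B) (c : σ.Val (srt a)) : DataAtom σ srt
  | eqArr (a b : B) (h : srt a = srt b) : DataAtom σ srt

/-- Truth of a Data-atom at `i`, where `e a` is the value `a(i)`. In `a(i) = b(i)` the two values
belong to the same sort `{0, …, top}` and are compared as numbers. -/
def DataAtom.Holds {σ : Sig} {B : Type} {srt : B → Fin σ.numData}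
    (e : (b : B) → σ.Val (srt b)) : DataAtom σ srt → Prop
  | eqVal a c => e a = c
  | eqArr a b _ => (e a : ℕ) = (e b : ℕ)

/-- Data-formulas in one `Proc`-variable. -/
abbrev DataForm (σ : Sig) {B : Type} (srt : B → Fin σ.numData) : Type :=
  BoolComb (DataAtom σ srt)

/-- Extended arithmetic terms in one `Proc`-variable `i` (numerals are in `LinTerm`):
a parameter, an integer variable, `a(i)`, or `♯{k | ψ(k)}` with `ψ` a Data-formula. -/
inductive ExtTerm (σ : Sig) (X A : Type) {B : Type} (srt : B → Fin σ.numData) : Type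
  | par (p : Fin σ.numPar) : ExtTerm σ X A srt
  | var (x : X) : ExtTerm σ X A srt
  | arr (a : A) : ExtTerm σ X A srt
  | card (ψ : DataForm σ srt) : ExtTerm σ X A srt

/-- The formulas `φ(i)`: Boolean combinations of Data-atoms and extended arithmetic atoms. -/
abbrev Matrix₁ (σ : Sig) (X A : Type) {B : Type} (srt : B → Fin σ.numData) : Type :=
  BoolComb (DataAtom σ srt ⊕ ArithAtom (ExtTerm σ X A srt))

/-- Finite disjunctions of formulas `∀ i, φ(i)`, given by the list of the `φ`. -/
abbrev UForm (σ : Sig) (X A : Type) {B : Type} (srt : B → Fin σ.numData) : Type :=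
  List (Matrix₁ σ X A srt)

/-- An interpretation of the variables in a model. -/
structure Interp {σ : Sig} (M : Model σ) (X A : Type) {B : Type} (srt : B → Fin σ.numData) where
  int : X → ℤ
  arr : A → M.Proc → ℤ
  enum : (b : B) → M.Proc → σ.Val (srt b)

/-- The interpretation of the variables `v, v'` made of one of `v` and one of `v'`;
`Sum.inl` marks the unprimed variables, `Sum.inr` the primed ones. -/
def Interp.pair {σ : Sig} {M : Model σ} {X A B : Type} {srt : B → Fin σ.numData}
    (I I' : Interp M X A srt) : Interp M (X ⊕ X) (A ⊕ A) (Sum.elim srt srt) where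
  int := Sum.elim I.int I'.int
  arr := Sum.elim I.arr I'.arr
  enum
    | Sum.inl b => I.enum b
    | Sum.inr b => I'.enum b

section Semantics

variable {σ : Sig} {M : Model σ} {X A B : Type} {srt : B → Fin σ.numData}

/-- Truth of a Data-formula at the process `i`. -/
def Interp.DataTrue (I : Interp M X A srt) (i : M.Proc) (ψ : DataForm σ srt) : Prop :=
  ψ.Holds (fun d => d.Holds (fun b => I.enum b i))

/-- The value of an extended arithmetic term at the process `i`. -/
noncomputable def Interp.extVal (I : Interp M X A srt) (i : M.Proc) : ExtTerm σ X A srt → ℤ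
  | .par p => M.par p
  | .var x => I.int x
  | .arr a => I.arr a i
  | .card ψ => (Nat.card {k : M.Proc // I.DataTrue k ψ} : ℤ)

/-- Truth of `φ(i)` at the process `i`. -/
def Interp.MatrixTrue (I : Interp M X A srt) (i : M.Proc) (φ : Matrix₁ σ X A srt) : Prop :=
  φ.Holds (Sum.elim (fun d => d.Holds (fun b => I.enum b i)) (fun a => a.Holds (I.extVal i)))

/-- Truth of a disjunction of formulas `∀ i, φ(i)`. -/
def Interp.Sat (I : Interp M X A srt) (Φ : UForm σ X A srt) : Prop :=
  ∃ φ ∈ Φ, ∀ i : M.Proc, I.MatrixTrue i φ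

end Semantics

/-! ## Formulas of linear arithmetic -/

/-- Basic terms of linear arithmetic: `p` parameters, free integer variables `X`,
and `n` bound integer variables. -/
inductive ArithSym (p : ℕ) (X : Type) (n : ℕ) : Type
  | par (c : Fin p) : ArithSym p X n
  | var (x : X) : ArithSym p X n
  | bound (j : Fin n) : ArithSym p X n

/-- The value of a basic term. -/
def ArithSym.eval {p : ℕ} {X : Type} {n : ℕ} (π : Fin p → ℤ) (x : X → ℤ) (e : Fin n → ℤ) :
    ArithSym p X n → ℤ
  | par c => π c
  | var y => x y
  | bound j => e j

/-- First-order formulas of linear (Presburger) arithmetic over `ℤ`; a quantifier in a formula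
with `n` bound variables in scope binds the variable with number `n`. -/
inductive ArithForm (p : ℕ) (X : Type) : ℕ → Type
  | tt {n : ℕ} : ArithForm p X n
  | ff {n : ℕ} : ArithForm p X n
  | atom {n : ℕ} (a : ArithAtom (ArithSym p X n)) : ArithForm p X n
  | neg {n : ℕ} (φ : ArithForm p X n) : ArithForm p X n
  | and {n : ℕ} (φ ψ : ArithForm p X n) : ArithForm p X n
  | or {n : ℕ} (φ ψ : ArithForm p X n) : ArithForm p X n
  | ex {n : ℕ} (φ : ArithForm p X (n + 1)) : ArithForm p X n
  | all {n : ℕ} (φ : ArithForm p X (n + 1)) : ArithForm p X n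

/-- Truth over `ℤ`, with `e` the values of the bound variables in scope. -/
def ArithForm.Holds {p : ℕ} {X : Type} (π : Fin p → ℤ) (x : X → ℤ) :
    {n : ℕ} → (Fin n → ℤ) → ArithForm p X n → Prop
  | _, _, tt => True
  | _, _, ff => False
  | _, e, atom a => a.Holds (ArithSym.eval π x e)
  | _, e, neg φ => ¬ φ.Holds π x e
  | _, e, and φ ψ => φ.Holds π x e ∧ ψ.Holds π x e
  | _, e, or φ ψ => φ.Holds π x e ∨ ψ.Holds π x e
  | _, e, ex φ => ∃ z : ℤ, φ.Holds π x (Fin.snoc (α := fun _ => ℤ) e z)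
  | _, e, all φ => ∀ z : ℤ, φ.Holds π x (Fin.snoc (α := fun _ => ℤ) e z)

/-- Truth of a formula of linear arithmetic without unbound bound-variables. -/
def ArithForm.Sat {p : ℕ} {X : Type} (φ : ArithForm p X 0) (π : Fin p → ℤ) (x : X → ℤ) : Prop :=
  φ.Holds π x Fin.elim0

/-- Open (quantifier-free) formulas of linear arithmetic. -/
abbrev OpenForm (p : ℕ) (X : Type) : Type := BoolComb (ArithAtom (ArithSym p X 0))

/-- Truth of an open formula. -/
def OpenSat {p : ℕ} {X : Type} (ψ : OpenForm p X) (π : Fin p → ℤ) (x : X → ℤ) : Prop :=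
  ψ.Holds (fun a => a.Holds (ArithSym.eval π x Fin.elim0))

/-! ## System specifications -/

/-- System specifications over the signature `σ` whose variables are integer variables and
arithmetic and enumerated array-ids, where the invariant `inv`, the initial formula `init` and
the transition formula `trans` are disjunctions of formulas `∀ i, φ(i)`, and the observable
propositions are open formulas of linear arithmetic in the integer variables. -/
structure Spec (σ : Sig) where
  numInt : ℕ
  numArr : ℕ
  numEnum : ℕ
  srt : Fin numEnum → Fin σ.numData
  inv : UForm σ (Fin numInt) (Fin numArr) srt
  init : UForm σ (Fin numInt) (Fin numArr) srt
  trans : UForm σ (Fin numInt ⊕ Fin numInt) (Fin numArr ⊕ Fin numArr) (Sum.elim srt srt)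
  AP : Set (OpenForm σ.numPar (Fin numInt))
  init_inv : ∀ (M : Model σ) (I : Interp M (Fin numInt) (Fin numArr) srt),
    I.Sat init → I.Sat inv
  trans_inv : ∀ (M : Model σ) (I I' : Interp M (Fin numInt) (Fin numArr) srt),
    I.Sat inv → (I.pair I').Sat trans → I'.Sat inv

/-- Interpretations of the variables of a specification. -/
abbrev Spec.Int {σ : Sig} (S : Spec σ) (M : Model σ) : Type :=
  Interp M (Fin S.numInt) (Fin S.numArr) S.srt

/-- The transition system of a specification. A state is a model together with an interpretation
of the variables in it; a transition does not change the model. -/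
def Spec.ts {σ : Sig} (S : Spec σ) : TransitionSystem (Σ M : Model σ, S.Int M) S.AP where
  W := {s | s.2.Sat S.inv}
  W₀ := {s | s.2.Sat S.init}
  R s s' := ∃ (M : Model σ) (I I' : S.Int M), s = ⟨M, I⟩ ∧ s' = ⟨M, I'⟩ ∧
    I.Sat S.inv ∧ I'.Sat S.inv ∧ (I.pair I').Sat S.trans
  V s := {ψ | OpenSat ψ.1 s.1.par s.2.int}
  init_sub s hs := S.init_inv s.1 s.2 hs
  rel_sub := by
    rintro _ _ ⟨M, I, I', rfl, rfl, h, h', -⟩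
    exact ⟨h, h'⟩

/-- System specifications over the arithmetic subsignature of `σ` with `n` integer variables
and observable propositions `AP`. -/
structure CounterSpec (σ : Sig) (n : ℕ) (AP : Set (OpenForm σ.numPar (Fin n))) where
  inv : ArithForm σ.numPar (Fin n) 0
  init : ArithForm σ.numPar (Fin n) 0
  trans : ArithForm σ.numPar (Fin n ⊕ Fin n) 0
  init_inv : ∀ (p : ArithModel σ) (x : Fin n → ℤ), init.Sat p.1 x → inv.Sat p.1 x
  trans_inv : ∀ (p : ArithModel σ) (x x' : Fin n → ℤ),
    inv.Sat p.1 x → trans.Sat p.1 (Sum.elim x x') → inv.Sat p.1 x'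

/-- The transition system of a specification over the arithmetic subsignature. -/
def CounterSpec.ts {σ : Sig} {n : ℕ} {AP : Set (OpenForm σ.numPar (Fin n))}
    (C : CounterSpec σ n AP) : TransitionSystem (ArithModel σ × (Fin n → ℤ)) AP where
  W := {s | C.inv.Sat s.1.1 s.2}
  W₀ := {s | C.init.Sat s.1.1 s.2}
  R s s' := s.1 = s'.1 ∧ C.inv.Sat s.1.1 s.2 ∧ C.inv.Sat s'.1.1 s'.2 ∧
    C.trans.Sat s.1.1 (Sum.elim s.2 s'.2)
  V s := {ψ | OpenSat ψ.1 s.1.1 s.2}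
  init_sub s hs := C.init_inv s.1 s.2 hs
  rel_sub _ _ h := ⟨h.2.1, h.2.2.1⟩

/-- `C` is a counter abstraction of `S`, i.e. a sub-system specification over the arithmetic
subsignature and the integer variables of `S`. -/
structure IsCounterAbstraction {σ : Sig} (S : Spec σ) (C : CounterSpec σ S.numInt S.AP) :
    Prop where
  inv : ∀ (M : Model σ) (I : S.Int M), I.Sat S.inv → C.inv.Sat M.par I.int
  init : ∀ (M : Model σ) (I : S.Int M), I.Sat S.init → C.init.Sat M.par I.int
  trans : ∀ (M : Model σ) (I I' : S.Int M), I.Sat S.inv → (I.pair I').Sat S.trans →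
    C.trans.Sat M.par (Sum.elim I.int I'.int)

/-- The projection of the states of `S` to the states of `C`. -/
def projection {σ : Sig} (S : Spec σ) (C : CounterSpec σ S.numInt S.AP) :
    (Σ M : Model σ, S.Int M) → ArithModel σ × (Fin S.numInt → ℤ) → Prop :=
  fun s t => s ∈ S.ts.W ∧ t ∈ C.ts.W ∧ t = (s.1.restrict, s.2.int)

/-- `C` is a strongest counter abstraction of `S`. -/
def IsStrongestCounterAbstraction {σ : Sig} (S : Spec σ) (C : CounterSpec σ S.numInt S.AP) :
    Prop :=
  IsCounterAbstraction S C ∧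
    ∀ C' : CounterSpec σ S.numInt S.AP, IsCounterAbstraction S C' → C.ts.Le C'.ts

/-! ## Gödel numbers, for computability -/

/-- Gödel number of a Boolean combination, given those of the atoms. -/
def BoolComb.code {α : Type} (c : α → ℕ) : BoolComb α → ℕ
  | tt => Nat.pair 0 0
  | ff => Nat.pair 0 1
  | atom a => Nat.pair 1 (c a)
  | neg φ => Nat.pair 2 (φ.code c)
  | and φ ψ => Nat.pair 3 (Nat.pair (φ.code c) (ψ.code c))
  | or φ ψ => Nat.pair 4 (Nat.pair (φ.code c) (ψ.code c))

/-- Gödel number of a term. -/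
def LinTerm.code {L : Type} (c : L → ℕ) : LinTerm L → ℕ
  | num k => Nat.pair 0 (Encodable.encode k)
  | basic l => Nat.pair 1 (c l)
  | add s t => Nat.pair 2 (Nat.pair (s.code c) (t.code c))
  | sub s t => Nat.pair 3 (Nat.pair (s.code c) (t.code c))

/-- Gödel number of an arithmetic atom. -/
def ArithAtom.code {L : Type} (c : L → ℕ) : ArithAtom L → ℕ
  | eq s t => Nat.pair 0 (Nat.pair (s.code c) (t.code c))
  | lt s t => Nat.pair 1 (Nat.pair (s.code c) (t.code c))
  | le s t => Nat.pair 2 (Nat.pair (s.code c) (t.code c))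
  | modEq n s t => Nat.pair 3 (Nat.pair n (Nat.pair (s.code c) (t.code c)))

/-- Gödel number of a Data-atom. -/
def DataAtom.code {σ : Sig} {B : Type} [Encodable B] {srt : B → Fin σ.numData} :
    DataAtom σ srt → ℕ
  | eqVal a c => Nat.pair 0 (Nat.pair (Encodable.encode a) (c : ℕ))
  | eqArr a b _ => Nat.pair 1 (Nat.pair (Encodable.encode a) (Encodable.encode b))

/-- Gödel number of a basic extended arithmetic term. -/
def ExtTerm.code {σ : Sig} {X A B : Type} [Encodable X] [Encodable A] [Encodable B]
    {srt : B → Fin σ.numData} : ExtTerm σ X A srt → ℕ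
  | par p => Nat.pair 0 (p : ℕ)
  | var x => Nat.pair 1 (Encodable.encode x)
  | arr a => Nat.pair 2 (Encodable.encode a)
  | card ψ => Nat.pair 3 (ψ.code DataAtom.code)

/-- Gödel number of `φ(i)`. -/
def matrixCode {σ : Sig} {X A B : Type} [Encodable X] [Encodable A] [Encodable B]
    {srt : B → Fin σ.numData} (φ : Matrix₁ σ X A srt) : ℕ :=
  φ.code (Sum.elim (fun d => Nat.pair 0 d.code) (fun a => Nat.pair 1 (a.code ExtTerm.code)))

/-- Gödel number of a disjunction of formulas `∀ i, φ(i)`. -/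
def uformCode {σ : Sig} {X A B : Type} [Encodable X] [Encodable A] [Encodable B]
    {srt : B → Fin σ.numData} (Φ : UForm σ X A srt) : ℕ :=
  Encodable.encode (Φ.map matrixCode)

/-- Gödel number of a basic term of linear arithmetic. -/
def ArithSym.code {p : ℕ} {X : Type} [Encodable X] {n : ℕ} : ArithSym p X n → ℕ
  | par c => Nat.pair 0 (c : ℕ)
  | var x => Nat.pair 1 (Encodable.encode x)
  | bound j => Nat.pair 2 (j : ℕ)

/-- Gödel number of a formula of linear arithmetic. -/
def ArithForm.code {p : ℕ} {X : Type} [Encodable X] : {n : ℕ} → ArithForm p X n → ℕ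
  | _, tt => Nat.pair 0 0
  | _, ff => Nat.pair 0 1
  | _, atom a => Nat.pair 1 (a.code ArithSym.code)
  | _, neg φ => Nat.pair 2 φ.code
  | _, and φ ψ => Nat.pair 3 (Nat.pair φ.code ψ.code)
  | _, or φ ψ => Nat.pair 4 (Nat.pair φ.code ψ.code)
  | _, ex φ => Nat.pair 5 φ.code
  | _, all φ => Nat.pair 6 φ.code

/-- Gödel number of a signature. -/
def Sig.code (σ : Sig) : ℕ :=
  Encodable.encode (σ.numPar, (σ.N : ℕ), List.ofFn σ.top, σ.emptyProc)

/-- Gödel number of a specification: signature, variables, and the three formulas. -/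
def Spec.code {σ : Sig} (S : Spec σ) : ℕ :=
  Encodable.encode (σ.code, S.numInt, S.numArr, List.ofFn (fun b => (S.srt b : ℕ)),
    uformCode S.inv, uformCode S.init, uformCode S.trans)

/-- Gödel number of a specification over the arithmetic subsignature: its three formulas. -/
def CounterSpec.code {σ : Sig} {n : ℕ} {AP : Set (OpenForm σ.numPar (Fin n))}
    (C : CounterSpec σ n AP) : ℕ :=
  Encodable.encode (C.inv.code, C.init.code, C.trans.code)

end CounterAbs

open CounterAbs

/-!
The truth of `φ(i)` at a process `i` depends only on the values at `i` of the enumerated array-ids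
(the "colour" of `i`, one of finitely many), on the integers `a(i)`, on the integer variables and
parameters, and on the numbers `n_t` of processes of each colour `t`: a cardinality `♯{k | ψ(k)}`
is the sum of the `n_t` over the colours `t` satisfying `ψ`. The values of the array-ids at
different processes can be chosen independently. Hence `∃ v₁, ∀ i, φ(i)` holds in a model iff there
are integers `n_t ≥ 0` with sum `N` such that, for each `t`, either `n_t = 0` or some integers `z`
satisfy the translation of `φ` for the colour `t`, where `a(i)` is replaced by an entry of `z`:
the same `z` can serve all processes of colour `t`, and every such family `n_t` is realised by a
colouring of the processes. This is a formula of linear arithmetic (`Scheme.elim`, `Scheme.sat_elim`). Applied to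
the invariant and the initial formula, and to `Φ ∧ τ` over two copies of the variables, it gives
the three formulas of `Spec.counterSpec`. Being equivalent to the projections of the formulas of
the specification, they are the strongest that a counter abstraction can have.

For the computability, colours are numbers whose digits are the values of the array-ids (`digit`),
and the translation is carried out on Gödel numbers by a fold over codes of syntax trees
(`codeFold`) which is primitive recursive. In `Φ ∧ τ` the number of a variable of `Φ` has to be
doubled, as the unprimed variables are the left summands; therefore the translation
takes a factor `s` for the numbers of variables. `Scheme.Coded.code_elim` shows that the functions
on Gödel numbers agree with the translation of formulas.
-/

namespace CounterAbs

/-! ### Iterated connectives and quantifiers -/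

section Formulas

variable {p : ℕ} {X : Type} {n : ℕ}

/-- The conjunction of a list of formulas. -/
def ArithForm.conj (l : List (ArithForm p X n)) : ArithForm p X n := l.foldr .and .tt

/-- The disjunction of a list of formulas. -/
def ArithForm.disj (l : List (ArithForm p X n)) : ArithForm p X n := l.foldr .or .ff

/-- `k` existential quantifiers in front of a formula. -/
def ArithForm.exs : (k : ℕ) → ArithForm p X (n + k) → ArithForm p X n
  | 0, φ => φ
  | k + 1, φ => exs k φ.ex

variable {π : Fin p → ℤ} {x : X → ℤ} {e : Fin n → ℤ}

theorem ArithForm.holds_conj (l : List (ArithForm p X n)) :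
    (conj l).Holds π x e ↔ ∀ φ ∈ l, φ.Holds π x e := by
  induction l with
  | nil => simp [conj, Holds]
  | cons φ l ih =>
    rw [List.forall_mem_cons, ← ih]
    rfl

theorem ArithForm.holds_disj (l : List (ArithForm p X n)) :
    (disj l).Holds π x e ↔ ∃ φ ∈ l, φ.Holds π x e := by
  induction l with
  | nil => simp [disj, Holds]
  | cons φ l ih =>
    simp only [List.mem_cons, exists_eq_or_imp, ← ih]
    rfl

theorem ArithForm.holds_exs (k : ℕ) (φ : ArithForm p X (n + k)) :
    (exs k φ).Holds π x e ↔ ∃ z : Fin k → ℤ, φ.Holds π x (Fin.append e z) := by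
  induction k with
  | zero =>
    have h (z : Fin 0 → ℤ) : Fin.append e z = e := Fin.append_right_nil e z rfl
    simp only [exs, h]
    exact ⟨fun h => ⟨Fin.elim0, h⟩, fun ⟨_, h⟩ => h⟩
  | succ k ih =>
    simp only [exs, ih, Holds]
    constructor
    · rintro ⟨z, y, h⟩
      refine ⟨Fin.snoc (α := fun _ => ℤ) z y, ?_⟩
      rwa [Fin.append_snoc]
    · rintro ⟨z, h⟩
      refine ⟨Fin.init z, z (Fin.last k), ?_⟩
      rwa [← Fin.append_snoc, Fin.snoc_init_self]

/-- Replacement of the basic terms of a term by terms. -/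
def LinTerm.bind {L L' : Type} (f : L → LinTerm L') : LinTerm L → LinTerm L'
  | num c => num c
  | basic l => f l
  | add s t => add (s.bind f) (t.bind f)
  | sub s t => sub (s.bind f) (t.bind f)

theorem LinTerm.eval_bind {L L' : Type} (f : L → LinTerm L') (v : L' → ℤ) (s : LinTerm L) :
    (s.bind f).eval v = s.eval (fun l => (f l).eval v) := by
  induction s <;> simp_all [bind, eval]

/-- Replacement of the basic terms of an atom by terms. -/
def ArithAtom.bind {L L' : Type} (f : L → LinTerm L') : ArithAtom L → ArithAtom L'
  | eq s t => eq (s.bind f) (t.bind f)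
  | lt s t => lt (s.bind f) (t.bind f)
  | le s t => le (s.bind f) (t.bind f)
  | modEq n s t => modEq n (s.bind f) (t.bind f)

theorem ArithAtom.holds_bind {L L' : Type} (f : L → LinTerm L') (v : L' → ℤ) (a : ArithAtom L) :
    (a.bind f).Holds v ↔ a.Holds (fun l => (f l).eval v) := by
  cases a <;> simp [bind, Holds, LinTerm.eval_bind]

open Classical in
/-- The sum of the variables `idx t` over the `t` with `P t`. -/
noncomputable def sumTerm {m : ℕ} (idx : Fin m → Fin n) (P : Fin m → Prop) :
    LinTerm (ArithSym p X n) :=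
  (List.finRange m).foldr
    (fun t s => if P t then .add (.basic (.bound (idx t))) s else s) (.num 0)

open Classical in
theorem eval_sumTerm {m : ℕ} (idx : Fin m → Fin n) (P : Fin m → Prop) :
    (sumTerm idx P).eval (ArithSym.eval π x e) = ∑ t with P t, e (idx t) := by
  have (l : List (Fin m)) :
      (l.foldr (fun t s => if P t then .add (.basic (.bound (idx t))) s else s)
        (.num 0) : LinTerm (ArithSym p X n)).eval (ArithSym.eval π x e) =
        (l.map fun t => if P t then e (idx t) else 0).sum := by
    induction l with
    | nil => rfl
    | cons t l ih =>
      simp only [List.foldr_cons, List.map_cons, List.sum_cons, ← ih]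
      split_ifs <;> simp [LinTerm.eval, ArithSym.eval]
  rw [sumTerm, this, Finset.sum_filter, ← List.sum_ofFn, List.ofFn_eq_map]

end Formulas

/-! ### Colourings of the processes -/

section Colouring

variable {α : Type} [Finite α] {m : ℕ}

/-- The number of elements of each colour. -/
noncomputable def colourCount (c : α → Fin m) (t : Fin m) : ℤ := Nat.card {i // c i = t}

open Classical in
theorem card_colour_mem (c : α → Fin m) (P : Fin m → Prop) :
    (Nat.card {i // P (c i)} : ℤ) = ∑ t with P t, colourCount c t := by
  have := Fintype.ofFinite α
  simp only [colourCount, Nat.card_eq_fintype_card, Fintype.card_subtype]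
  norm_cast
  rw [Finset.card_eq_sum_card_fiberwise (f := c) (t := Finset.univ.filter P)]
  · refine Finset.sum_congr rfl fun t ht => ?_
    congr 1
    ext i
    simp only [Finset.mem_filter, Finset.mem_univ, true_and] at ht ⊢
    constructor
    · exact fun h => h.2
    · rintro rfl
      exact ⟨ht, rfl⟩
  · intro i hi
    simpa using hi

theorem colourCount_ne_zero (c : α → Fin m) (i : α) : colourCount c (c i) ≠ 0 := by
  have : Nonempty {j // c j = c i} := ⟨⟨i, rfl⟩⟩
  simp only [colourCount, ne_eq, Nat.cast_eq_zero]
  exact Nat.card_pos.ne'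

theorem exists_colourCount_eq (n : Fin m → ℤ) (h0 : ∀ t, 0 ≤ n t)
    (hn : ∑ t, n t = (Nat.card α : ℤ)) : ∃ c : α → Fin m, colourCount c = n := by
  lift n to Fin m → ℕ using h0
  have hcard : Nat.card α = Nat.card (Σ t : Fin m, Fin (n t)) := by
    rw [Nat.card_eq_fintype_card (α := Σ t : Fin m, Fin (n t)), Fintype.card_sigma]
    simp only [Fintype.card_fin]
    beta_reduce at hn
    exact_mod_cast hn.symm
  let e : α ≃ Σ t : Fin m, Fin (n t) := (Finite.card_eq.1 hcard).some
  refine ⟨fun i => (e i).1, funext fun t => ?_⟩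
  have e' : {i // (e i).1 = t} ≃ Fin (n t) :=
    (e.subtypeEquiv (q := fun s => s.1 = t) fun _ => Iff.rfl).trans (Equiv.sigmaSubtype t)
  simp [colourCount, Nat.card_congr e']

end Colouring

/-! ### Elimination of the array-ids -/

/-- A way to describe interpretations of `X`, `A`, `B` by an assignment of the variables in `X'`,
a colouring of the processes by `Fin m`, and a tuple of `K` integers for each process:
an integer variable `x` gets the value of `intVar x`, an arithmetic array-id `a` stores the entry
`slot a` of the tuple, and an enumerated array-id `b` stores at a process of colour `t` the value
`val t b`. -/
structure Scheme (σ : Sig) (X A : Type) {B : Type} (srt : B → Fin σ.numData) (X' : Type)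
    (m K : ℕ) where
  intVar : X → X'
  slot : A → Fin K
  val : Fin m → (b : B) → σ.Val (srt b)

namespace Scheme

variable {σ : Sig} {X A B : Type} {srt : B → Fin σ.numData} {X' : Type} {m K : ℕ}

/-- The interpretation described by an assignment, a colouring and tuples of integers. -/
def interp (F : Scheme σ X A srt X' m K) {M : Model σ} (x : X' → ℤ) (c : M.Proc → Fin m)
    (z : M.Proc → Fin K → ℤ) : Interp M X A srt where
  int a := x (F.intVar a)
  arr a i := z i (F.slot a)
  enum b i := F.val (c i) b

/-- The bound variable for the number of processes of colour `t`, in the scope of the quantifiers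
over these numbers only. -/
abbrev countVar (t : Fin m) : Fin (0 + m) := Fin.natAdd 0 t

/-- The translation of a basic term: `a(i)` becomes the bound variable for its value, and
a cardinality the sum of the numbers of processes of the colours in question. -/
noncomputable def basicTerm (F : Scheme σ X A srt X' m K) :
    ExtTerm σ X A srt → LinTerm (ArithSym σ.numPar X' (0 + m + K))
  | .par p => .basic (.par p)
  | .var x => .basic (.var (F.intVar x))
  | .arr a => .basic (.bound (Fin.natAdd (0 + m) (F.slot a)))
  | .card ψ => sumTerm (fun t => Fin.castAdd K (countVar t))
      fun t => ψ.Holds fun d => d.Holds (F.val t)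

open Classical in
/-- The translation of `φ(i)` for a process `i` of colour `t`. -/
noncomputable def matrix (F : Scheme σ X A srt X' m K) (t : Fin m) :
    Matrix₁ σ X A srt → ArithForm σ.numPar X' (0 + m + K)
  | .tt => .tt
  | .ff => .ff
  | .atom (.inl d) => if d.Holds (F.val t) then .tt else .ff
  | .atom (.inr a) => .atom (a.bind F.basicTerm)
  | .neg φ => .neg (F.matrix t φ)
  | .and φ ψ => .and (F.matrix t φ) (F.matrix t ψ)
  | .or φ ψ => .or (F.matrix t φ) (F.matrix t ψ)

theorem eval_basicTerm (F : Scheme σ X A srt X' m K) {M : Model σ} (x : X' → ℤ)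
    (c : M.Proc → Fin m) (z : M.Proc → Fin K → ℤ) (i : M.Proc) (s : ExtTerm σ X A srt) :
    (F.basicTerm s).eval
        (ArithSym.eval M.par x (Fin.append (Fin.append Fin.elim0 (colourCount c)) (z i))) =
      (F.interp x c z).extVal i s := by
  have := M.finite
  cases s with
  | card ψ =>
    simp only [basicTerm, eval_sumTerm, Interp.extVal, Fin.append_left, Fin.append_right]
    exact (card_colour_mem c _).symm
  | _ => simp [basicTerm, LinTerm.eval, ArithSym.eval, Interp.extVal, interp]

theorem holds_matrix (F : Scheme σ X A srt X' m K) {M : Model σ} (x : X' → ℤ)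
    (c : M.Proc → Fin m) (z : M.Proc → Fin K → ℤ) (i : M.Proc) (φ : Matrix₁ σ X A srt) :
    (F.matrix (c i) φ).Holds M.par x
        (Fin.append (Fin.append Fin.elim0 (colourCount c)) (z i)) ↔
      (F.interp x c z).MatrixTrue i φ := by
  unfold Interp.MatrixTrue
  induction φ with
  | atom a =>
    rcases a with d | a
    · have : d.Holds (F.val (c i)) ↔ d.Holds (fun b => (F.interp x c z).enum b i) := Iff.rfl
      by_cases h : d.Holds (F.val (c i))
      · simp [matrix, h, ArithForm.Holds, BoolComb.Holds, this.1 h]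
      · simp [matrix, h, ArithForm.Holds, BoolComb.Holds, mt this.2 h]
    · simp only [matrix, ArithForm.Holds, BoolComb.Holds, Sum.elim_inr, ArithAtom.holds_bind,
        eval_basicTerm]
  | _ => simp_all [matrix, ArithForm.Holds, BoolComb.Holds]

/-- "There are `n_t` processes of colour `t`, and for each colour that occurs there are values of
the arithmetic array-ids with `θ t`". -/
noncomputable def someColouring (σ : Sig) (X' : Type) (m K : ℕ)
    (θ : Fin m → ArithForm σ.numPar X' (0 + m + K)) : ArithForm σ.numPar X' 0 :=
  .exs m (.and (.atom (.eq (sumTerm countVar fun _ => True) (.basic (.par σ.N))))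
    (.conj ((List.finRange m).map fun t =>
      .and (.atom (.le (.num 0) (.basic (.bound (countVar t)))))
        (.or (.atom (.eq (.basic (.bound (countVar t))) (.num 0))) (.exs K (θ t))))))

theorem sat_someColouring (M : Model σ) (x : X' → ℤ)
    (θ : Fin m → ArithForm σ.numPar X' (0 + m + K)) :
    (someColouring σ X' m K θ).Sat M.par x ↔
      ∃ (c : M.Proc → Fin m) (z : M.Proc → Fin K → ℤ), ∀ i, (θ (c i)).Holds M.par x
        (Fin.append (Fin.append Fin.elim0 (colourCount c)) (z i)) := by
  have := M.finite
  simp only [someColouring, ArithForm.Sat, ArithForm.holds_exs, ArithForm.Holds,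
    ArithAtom.Holds, eval_sumTerm, ArithForm.holds_conj, List.forall_mem_map, List.mem_finRange,
    LinTerm.eval, ArithSym.eval, Fin.append_right, true_imp_iff,
    Finset.filter_true, M.card_eq]
  constructor
  · rintro ⟨n, hn, h⟩
    obtain ⟨c, rfl⟩ := exists_colourCount_eq n (fun t => (h t).1) hn
    choose z hz using fun i => (h (c i)).2.resolve_left (colourCount_ne_zero c i)
    exact ⟨c, z, hz⟩
  · rintro ⟨c, z, h⟩
    refine ⟨colourCount c, ?_, fun t => ⟨by simp [colourCount], ?_⟩⟩
    · have := card_colour_mem c fun _ => True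
      simpa using this.symm
    · by_cases ht : ∃ i, c i = t
      · obtain ⟨i, rfl⟩ := ht
        exact .inr ⟨z i, h i⟩
      · have : IsEmpty {i // c i = t} := ⟨fun i => ht ⟨i.1, i.2⟩⟩
        exact .inl (by simp [colourCount])

variable {Y C D : Type} {srt' : D → Fin σ.numData}

/-- The formula of linear arithmetic which says that `Φ` and `Ψ` are true in the interpretations
described by some common colouring and tuples. -/
noncomputable def elim (F : Scheme σ X A srt X' m K) (G : Scheme σ Y C srt' X' m K)
    (Φ : UForm σ X A srt) (Ψ : UForm σ Y C srt') : ArithForm σ.numPar X' 0 :=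
  .disj (Φ.map fun φ => .disj (Ψ.map fun ψ =>
    someColouring σ X' m K fun t => .and (F.matrix t φ) (G.matrix t ψ)))

theorem sat_elim (F : Scheme σ X A srt X' m K) (G : Scheme σ Y C srt' X' m K)
    (Φ : UForm σ X A srt) (Ψ : UForm σ Y C srt') (M : Model σ) (x : X' → ℤ) :
    (elim F G Φ Ψ).Sat M.par x ↔ ∃ (c : M.Proc → Fin m) (z : M.Proc → Fin K → ℤ),
      (F.interp x c z).Sat Φ ∧ (G.interp x c z).Sat Ψ := by
  have h (φ ψ) := sat_someColouring M x fun t : Fin m =>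
    ArithForm.and (F.matrix (K := K) t φ) (G.matrix t ψ)
  simp only [ArithForm.Sat, ArithForm.Holds, holds_matrix] at h
  simp only [elim, ArithForm.Sat, ArithForm.holds_disj, List.mem_map, exists_exists_and_eq_and, h,
    Interp.Sat]
  constructor
  · rintro ⟨φ, hφ, ψ, hψ, c, z, h⟩
    exact ⟨c, z, ⟨φ, hφ, fun i => (h i).1⟩, ψ, hψ, fun i => (h i).2⟩
  · rintro ⟨c, z, ⟨φ, hφ, h⟩, ψ, hψ, h'⟩
    exact ⟨φ, hφ, ψ, hψ, c, z, fun i => ⟨h i, h' i⟩⟩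

end Scheme


/-! ### Primitive recursive functions on Gödel numbers -/

section CodeFold

variable {α β : Type}

/-- Recursion over Gödel numbers of syntax trees. Numbers `Nat.pair k q` with `k < 2` code leaves;
for `k ≥ 2` the children of the node are among those coded by `q` (unary nodes) and by the two
components of `q` (binary nodes), and the results for all three are passed on. -/
def codeFold (leaf : α → ℕ → β) (node : α → ℕ → β → β → β → β) (a : α) (n : ℕ) : β :=
  if h : 2 ≤ n.unpair.1 then
    have h₀ : n.unpair.2 < n := by
      have := Nat.add_le_pair n.unpair.1 n.unpair.2
      rw [Nat.pair_unpair] at this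
      omega
    have h₁ := (Nat.unpair_left_le n.unpair.2).trans_lt h₀
    have h₂ := (Nat.unpair_right_le n.unpair.2).trans_lt h₀
    node a n.unpair.1 (codeFold leaf node a n.unpair.2)
      (codeFold leaf node a n.unpair.2.unpair.1) (codeFold leaf node a n.unpair.2.unpair.2)
  else leaf a n

variable {leaf : α → ℕ → β} {node : α → ℕ → β → β → β → β}

theorem codeFold_leaf (a : α) {k : ℕ} (hk : k < 2) (q : ℕ) :
    codeFold leaf node a (Nat.pair k q) = leaf a (Nat.pair k q) := by
  rw [codeFold, dif_neg (by simpa using hk)]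

theorem codeFold_node (a : α) {k : ℕ} (hk : 2 ≤ k) (q : ℕ) :
    codeFold leaf node a (Nat.pair k q) = node a k (codeFold leaf node a q)
      (codeFold leaf node a q.unpair.1) (codeFold leaf node a q.unpair.2) := by
  rw [codeFold, dif_pos (by simpa using hk)]
  simp

theorem primrec_codeFold [Primcodable α] [Primcodable β] [Inhabited β] (hleaf : Primrec₂ leaf)
    (hnode : Primrec fun p : (α × ℕ) × β × β × β => node p.1.1 p.1.2 p.2.1 p.2.2.1 p.2.2.2) :
    Primrec₂ (codeFold leaf node) := by
  let g : α → List β → Option β := fun a l =>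
    if 2 ≤ l.length.unpair.1 then
      some (node a l.length.unpair.1 (l.getI l.length.unpair.2)
        (l.getI l.length.unpair.2.unpair.1) (l.getI l.length.unpair.2.unpair.2))
    else some (leaf a l.length)
  have hlen : Primrec fun p : α × List β => p.2.length := Primrec.list_length.comp Primrec.snd
  have h1 : Primrec fun p : α × List β => p.2.length.unpair.1 :=
    Primrec.fst.comp (Primrec.unpair.comp hlen)
  have h2 : Primrec fun p : α × List β => p.2.length.unpair.2 :=
    Primrec.snd.comp (Primrec.unpair.comp hlen)
  have hg : Primrec₂ g := by
    refine Primrec.ite (Primrec.nat_le.comp (Primrec.const 2) h1) (Primrec.option_some.comp ?_)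
      (Primrec.option_some.comp (hleaf.comp Primrec.fst hlen))
    refine hnode.comp (((Primrec.fst.pair h1)).pair ((Primrec.list_getI.comp Primrec.snd h2).pair
      ((Primrec.list_getI.comp Primrec.snd ?_).pair (Primrec.list_getI.comp Primrec.snd ?_))))
    · exact Primrec.fst.comp (Primrec.unpair.comp h2)
    · exact Primrec.snd.comp (Primrec.unpair.comp h2)
  refine Primrec.nat_strong_rec _ hg fun a n => ?_
  have hI {i : ℕ} (hi : i < n) :
      ((List.range n).map (codeFold leaf node a)).getI i = codeFold leaf node a i := by
    rw [List.getI_eq_getElem _ (by simpa using hi)]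
    simp
  simp only [g, List.length_map, List.length_range]
  conv_rhs => rw [codeFold]
  split_ifs with h
  · have h₀ : n.unpair.2 < n := by
      have := Nat.add_le_pair n.unpair.1 n.unpair.2
      rw [Nat.pair_unpair] at this
      omega
    rw [hI h₀, hI ((Nat.unpair_left_le _).trans_lt h₀), hI ((Nat.unpair_right_le _).trans_lt h₀)]
  · rfl

end CodeFold

section Closure

variable {α : Type} [Primcodable α] {f g h : α → ℕ}

theorem primrec_left (hf : Primrec f) : Primrec fun a => (f a).unpair.1 :=
  Primrec.fst.comp (Primrec.unpair.comp hf)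

theorem primrec_right (hf : Primrec f) : Primrec fun a => (f a).unpair.2 :=
  Primrec.snd.comp (Primrec.unpair.comp hf)

theorem primrec_natPair (hf : Primrec f) (hg : Primrec g) :
    Primrec fun a => Nat.pair (f a) (g a) :=
  Primrec₂.natPair.comp hf hg

theorem primrec_beq (hf : Primrec f) (hg : Primrec g) : Primrec fun a => f a == g a :=
  Primrec.beq.comp hf hg

theorem primrec_pow (hf : Primrec f) (hg : Primrec g) : Primrec fun a => f a ^ g a :=
  (Primrec₂.unpaired'.1 Nat.Primrec.pow).comp hf hg

theorem primrec_sum {l : α → List ℕ} (hl : Primrec l) : Primrec fun a => (l a).sum :=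
  Primrec.list_foldr hl (Primrec.const 0)
    (Primrec.nat_add.comp (Primrec.fst.comp Primrec.snd) (Primrec.snd.comp Primrec.snd)).to₂

end Closure

/-! ### Colours as numbers -/

/-- The number of colours used for enumerated array-ids which take the values `0, …, l[c]`:
numbers with `l.length` digits to the base `l.sum + 1`. -/
def numColours (l : List ℕ) : ℕ := (l.sum + 1) ^ l.length

/-- The value of the `c`-th enumerated array-id at processes of colour `t`. The last `mod` makes
this a legal value for all `t`, at the price of several colours with the same values. -/
def digit (l : List ℕ) (t c : ℕ) : ℕ := t / (l.sum + 1) ^ c % (l.sum + 1) % (l.getD c 0 + 1)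

theorem digit_lt (l : List ℕ) (t c : ℕ) : digit l t c < l.getD c 0 + 1 :=
  Nat.mod_lt _ (Nat.succ_pos _)

theorem exists_digit_eq (l : List ℕ) (v : ℕ → ℕ) (hv : ∀ c < l.length, v c ≤ l.getD c 0) :
    ∃ t : Fin (numColours l), ∀ c < l.length, digit l t c = v c := by
  have hlt (c : Fin l.length) : v c < l.sum + 1 := by
    have h := hv c c.2
    rw [List.getD_eq_getElem _ _ c.2] at h
    exact Nat.lt_succ_of_le (h.trans (List.single_le_sum (by simp) _ (List.getElem_mem c.2)))
  let t : Fin (numColours l) := finFunctionFinEquiv fun c => (⟨v c, hlt c⟩ : Fin (l.sum + 1))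
  refine ⟨t, fun c hc => ?_⟩
  have h : (finFunctionFinEquiv.symm t ⟨c, hc⟩ : ℕ) = v c := by simp [t]
  rw [digit, ← Nat.mod_eq_of_lt (Nat.lt_succ_of_le (hv c hc)), ← h]
  rfl

section Primrec

variable {α : Type} [Primcodable α] {l : α → List ℕ} {f g : α → ℕ}

theorem primrec_numColours (hl : Primrec l) : Primrec fun a => numColours (l a) :=
  primrec_pow (Primrec.succ.comp (primrec_sum hl)) (Primrec.list_length.comp hl)

theorem primrec_digit (hl : Primrec l) (hf : Primrec f) (hg : Primrec g) :
    Primrec fun a => digit (l a) (f a) (g a) :=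
  have hs := Primrec.succ.comp (primrec_sum hl)
  Primrec.nat_mod.comp (Primrec.nat_mod.comp (Primrec.nat_div.comp hf (primrec_pow hs hg)) hs)
    (Primrec.succ.comp ((Primrec.list_getD 0).comp hl hg))

end Primrec

/-! ### The elimination on Gödel numbers -/

/-- Truth of the Data-atom with Gödel number `q` at processes of colour `t`. Here, and in the
functions below, `e = (s, l)` where `l` determines the colours and the numbers of the variables
are to be multiplied by `s`. -/
def dataAtomTest (e : ℕ × List ℕ) (t q : ℕ) : Bool :=
  if q.unpair.1 = 0 then digit e.2 t (e.1 * q.unpair.2.unpair.1) == q.unpair.2.unpair.2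
  else digit e.2 t (e.1 * q.unpair.2.unpair.1) == digit e.2 t (e.1 * q.unpair.2.unpair.2)

/-- Truth of the Data-formula with Gödel number `q` at processes of colour `t`. -/
def dataTest (e : ℕ × List ℕ) (t q : ℕ) : Bool :=
  codeFold (fun a n => if n.unpair.1 = 0 then n.unpair.2 == 0 else
      dataAtomTest a.1 a.2 n.unpair.2)
    (fun _ k r r₁ r₂ => if k = 2 then !r else if k = 3 then r₁ && r₂ else r₁ || r₂) (e, t) q

/-- The Gödel number of `sumTerm`, where the colours are selected by the Data-formula with Gödel
number `q`. -/
def sumTermCode (e : ℕ × List ℕ) (q : ℕ) : ℕ :=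
  (List.range (numColours e.2)).foldr
    (fun t r => bif dataTest e t q then
      Nat.pair 2 (Nat.pair (Nat.pair 1 (Nat.pair 2 t)) r) else r)
    (Nat.pair 0 (Encodable.encode (0 : ℤ)))

/-- `Scheme.basicTerm` on Gödel numbers. -/
def basicTermCode (e : ℕ × List ℕ) (q : ℕ) : ℕ :=
  if q.unpair.1 = 0 then Nat.pair 1 q
  else if q.unpair.1 = 1 then Nat.pair 1 (Nat.pair 1 (e.1 * q.unpair.2))
  else if q.unpair.1 = 2 then Nat.pair 1 (Nat.pair 2 (numColours e.2 + e.1 * q.unpair.2))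
  else sumTermCode e q.unpair.2

/-- The translation of terms on Gödel numbers. -/
def termCode (e : ℕ × List ℕ) (q : ℕ) : ℕ :=
  codeFold (fun e n => if n.unpair.1 = 0 then n else basicTermCode e n.unpair.2)
    (fun _ k _ r₁ r₂ => Nat.pair k (Nat.pair r₁ r₂)) e q

/-- The translation of arithmetic atoms on Gödel numbers. -/
def atomCode (e : ℕ × List ℕ) (q : ℕ) : ℕ :=
  if q.unpair.1 = 3 then
    Nat.pair 3 (Nat.pair q.unpair.2.unpair.1
      (Nat.pair (termCode e q.unpair.2.unpair.2.unpair.1)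
        (termCode e q.unpair.2.unpair.2.unpair.2)))
  else Nat.pair q.unpair.1
    (Nat.pair (termCode e q.unpair.2.unpair.1) (termCode e q.unpair.2.unpair.2))

/-- `Scheme.matrix` on Gödel numbers. -/
def matrixTransCode (e : ℕ × List ℕ) (t q : ℕ) : ℕ :=
  codeFold (fun a n => if n.unpair.1 = 0 then n
      else if n.unpair.2.unpair.1 = 0 then
        bif dataAtomTest a.1 a.2 n.unpair.2.unpair.2 then Nat.pair 0 0 else Nat.pair 0 1
      else Nat.pair 1 (atomCode a.1 n.unpair.2.unpair.2))
    (fun _ k r r₁ r₂ => if k = 2 then Nat.pair 2 r else Nat.pair k (Nat.pair r₁ r₂)) (e, t) q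

/-- The Gödel number of a conjunction. -/
def conjCode (l : List ℕ) : ℕ :=
  l.foldr (fun a r => Nat.pair 3 (Nat.pair a r)) (Nat.pair 0 0)

/-- The Gödel number of a disjunction. -/
def disjCode (l : List ℕ) : ℕ :=
  l.foldr (fun a r => Nat.pair 4 (Nat.pair a r)) (Nat.pair 0 1)

/-- The Gödel number of a formula with `k` existential quantifiers in front. -/
def exsCode (k q : ℕ) : ℕ := (Nat.pair 5)^[k] q

/-- The conjunct for the colour `t` in `Scheme.someColouring`, on Gödel numbers. -/
def colourCode (K t θ : ℕ) : ℕ :=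
  Nat.pair 3 (Nat.pair
    (Nat.pair 1 (Nat.pair 2 (Nat.pair (Nat.pair 0 (Encodable.encode (0 : ℤ)))
      (Nat.pair 1 (Nat.pair 2 t)))))
    (Nat.pair 4 (Nat.pair
      (Nat.pair 1 (Nat.pair 0 (Nat.pair (Nat.pair 1 (Nat.pair 2 t))
        (Nat.pair 0 (Encodable.encode (0 : ℤ))))))
      (exsCode K θ))))

/-- `Scheme.elim` on Gödel numbers, where `N` is the number of the parameter for the number of
processes. In the sum of all `n_t` the colours are selected by the Gödel number of `tt`. -/
def elimCode (N K s s' : ℕ) (l Φ Ψ : List ℕ) : ℕ :=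
  disjCode (Φ.map fun φ => disjCode (Ψ.map fun ψ =>
    exsCode (numColours l) (Nat.pair 3 (Nat.pair
      (Nat.pair 1 (Nat.pair 0 (Nat.pair (sumTermCode (s, l) (Nat.pair 0 0))
        (Nat.pair 1 (Nat.pair 0 N)))))
      (conjCode ((List.range (numColours l)).map fun t => colourCode K t
        (Nat.pair 3 (Nat.pair (matrixTransCode (s, l) t φ) (matrixTransCode (s', l) t ψ)))))))))

section Primrec

variable {α : Type} [Primcodable α] {e : α → ℕ × List ℕ} {t q : α → ℕ}

theorem primrec_dataAtomTest (he : Primrec e) (ht : Primrec t) (hq : Primrec q) :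
    Primrec fun a => dataAtomTest (e a) (t a) (q a) := by
  have hs := Primrec.fst.comp he
  have hl := Primrec.snd.comp he
  have h₁ := primrec_digit hl ht (Primrec.nat_mul.comp hs (primrec_left (primrec_right hq)))
  have h₂ := primrec_digit hl ht (Primrec.nat_mul.comp hs (primrec_right (primrec_right hq)))
  exact Primrec.ite (Primrec.eq.comp (primrec_left hq) (Primrec.const 0))
    (primrec_beq h₁ (primrec_right (primrec_right hq))) (primrec_beq h₁ h₂)

theorem primrec_dataTest (he : Primrec e) (ht : Primrec t) (hq : Primrec q) :
    Primrec fun a => dataTest (e a) (t a) (q a) := by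
  refine (primrec_codeFold ?_ ?_).comp (he.pair ht) hq
  · exact Primrec.ite (Primrec.eq.comp (primrec_left Primrec.snd) (Primrec.const 0))
      (primrec_beq (primrec_right Primrec.snd) (Primrec.const 0))
      (primrec_dataAtomTest (Primrec.fst.comp Primrec.fst) (Primrec.snd.comp Primrec.fst)
        (primrec_right Primrec.snd))
  · have hk := Primrec.snd.comp (Primrec.fst (α := (((ℕ × List ℕ) × ℕ) × ℕ))
      (β := Bool × Bool × Bool))
    have hr := Primrec.snd (α := (((ℕ × List ℕ) × ℕ) × ℕ)) (β := Bool × Bool × Bool)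
    have h₁ := Primrec.fst.comp (Primrec.snd.comp hr)
    have h₂ := Primrec.snd.comp (Primrec.snd.comp hr)
    exact Primrec.ite (Primrec.eq.comp hk (Primrec.const 2))
      (Primrec.not.comp (Primrec.fst.comp hr))
      (Primrec.ite (Primrec.eq.comp hk (Primrec.const 3)) (Primrec.and.comp h₁ h₂)
        (Primrec.or.comp h₁ h₂))

theorem primrec_sumTermCode (he : Primrec e) (hq : Primrec q) :
    Primrec fun a => sumTermCode (e a) (q a) := by
  refine Primrec.list_foldr (h := fun a p => bif dataTest (e a) p.1 (q a) then
      Nat.pair 2 (Nat.pair (Nat.pair 1 (Nat.pair 2 p.1)) p.2) else p.2)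
    (Primrec.list_range.comp (primrec_numColours (Primrec.snd.comp he))) (Primrec.const _) ?_
  have ht := Primrec.fst.comp (Primrec.snd (α := α) (β := ℕ × ℕ))
  have hr := Primrec.snd.comp (Primrec.snd (α := α) (β := ℕ × ℕ))
  exact Primrec.cond (primrec_dataTest (he.comp Primrec.fst) ht (hq.comp Primrec.fst))
    (primrec_natPair (Primrec.const 2) (primrec_natPair
      (primrec_natPair (Primrec.const 1) (primrec_natPair (Primrec.const 2) ht)) hr)) hr

theorem primrec_basicTermCode (he : Primrec e) (hq : Primrec q) :
    Primrec fun a => basicTermCode (e a) (q a) := by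
  have hk (k : ℕ) : PrimrecPred fun a => (q a).unpair.1 = k :=
    Primrec.eq.comp (primrec_left hq) (Primrec.const k)
  have hm := Primrec.nat_mul.comp (Primrec.fst.comp he) (primrec_right hq)
  exact Primrec.ite (hk 0) (primrec_natPair (Primrec.const 1) hq)
    (Primrec.ite (hk 1) (primrec_natPair (Primrec.const 1) (primrec_natPair (Primrec.const 1) hm))
      (Primrec.ite (hk 2) (primrec_natPair (Primrec.const 1) (primrec_natPair (Primrec.const 2)
        (Primrec.nat_add.comp (primrec_numColours (Primrec.snd.comp he)) hm)))
        (primrec_sumTermCode he (primrec_right hq))))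

theorem primrec_termCode (he : Primrec e) (hq : Primrec q) :
    Primrec fun a => termCode (e a) (q a) := by
  refine (primrec_codeFold ?_ ?_).comp he hq
  · exact Primrec.ite (Primrec.eq.comp (primrec_left Primrec.snd) (Primrec.const 0)) Primrec.snd
      (primrec_basicTermCode Primrec.fst (primrec_right Primrec.snd))
  · have hr := Primrec.snd.comp
      (Primrec.snd (α := ((ℕ × List ℕ) × ℕ)) (β := ℕ × ℕ × ℕ))
    exact primrec_natPair (Primrec.snd.comp Primrec.fst)
      (primrec_natPair (Primrec.fst.comp hr) (Primrec.snd.comp hr))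

theorem primrec_atomCode (he : Primrec e) (hq : Primrec q) :
    Primrec fun a => atomCode (e a) (q a) := by
  have h := primrec_right hq
  have h' := primrec_right h
  exact Primrec.ite (Primrec.eq.comp (primrec_left hq) (Primrec.const 3))
    (primrec_natPair (Primrec.const 3) (primrec_natPair (primrec_left h)
      (primrec_natPair (primrec_termCode he (primrec_left h'))
        (primrec_termCode he (primrec_right h')))))
    (primrec_natPair (primrec_left hq) (primrec_natPair (primrec_termCode he (primrec_left h))
      (primrec_termCode he (primrec_right h))))

theorem primrec_matrixTransCode (he : Primrec e) (ht : Primrec t) (hq : Primrec q) :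
    Primrec fun a => matrixTransCode (e a) (t a) (q a) := by
  refine (primrec_codeFold ?_ ?_).comp (he.pair ht) hq
  · have hn := Primrec.snd (α := (ℕ × List ℕ) × ℕ) (β := ℕ)
    have h := primrec_right hn
    have he' := Primrec.fst.comp (Primrec.fst (α := (ℕ × List ℕ) × ℕ) (β := ℕ))
    exact Primrec.ite (Primrec.eq.comp (primrec_left hn) (Primrec.const 0)) hn
      (Primrec.ite (Primrec.eq.comp (primrec_left h) (Primrec.const 0))
        (Primrec.cond (primrec_dataAtomTest he' (Primrec.snd.comp Primrec.fst) (primrec_right h))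
          (Primrec.const _) (Primrec.const _))
        (primrec_natPair (Primrec.const 1) (primrec_atomCode he' (primrec_right h))))
  · have hk := Primrec.snd.comp (Primrec.fst (α := (((ℕ × List ℕ) × ℕ) × ℕ)) (β := ℕ × ℕ × ℕ))
    have hr := Primrec.snd (α := (((ℕ × List ℕ) × ℕ) × ℕ)) (β := ℕ × ℕ × ℕ)
    exact Primrec.ite (Primrec.eq.comp hk (Primrec.const 2))
      (primrec_natPair (Primrec.const 2) (Primrec.fst.comp hr))
      (primrec_natPair hk (primrec_natPair (Primrec.fst.comp (Primrec.snd.comp hr))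
        (Primrec.snd.comp (Primrec.snd.comp hr))))

theorem primrec_conjCode {l : α → List ℕ} (hl : Primrec l) : Primrec fun a => conjCode (l a) :=
  Primrec.list_foldr hl (Primrec.const _) (primrec_natPair (Primrec.const 3)
    (primrec_natPair (Primrec.fst.comp Primrec.snd) (Primrec.snd.comp Primrec.snd))).to₂

theorem primrec_disjCode {l : α → List ℕ} (hl : Primrec l) : Primrec fun a => disjCode (l a) :=
  Primrec.list_foldr hl (Primrec.const _) (primrec_natPair (Primrec.const 4)
    (primrec_natPair (Primrec.fst.comp Primrec.snd) (Primrec.snd.comp Primrec.snd))).to₂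

theorem primrec_exsCode (ht : Primrec t) (hq : Primrec q) :
    Primrec fun a => exsCode (t a) (q a) :=
  Primrec.nat_iterate ht hq (primrec_natPair (Primrec.const 5) Primrec.snd).to₂

theorem primrec_colourCode {K : α → ℕ} (hK : Primrec K) (ht : Primrec t) (hq : Primrec q) :
    Primrec fun a => colourCode (K a) (t a) (q a) := by
  have hn := primrec_natPair (Primrec.const 1) (primrec_natPair (Primrec.const 2) ht)
  have h0 : Primrec fun _ : α => Nat.pair 0 (Encodable.encode (0 : ℤ)) := Primrec.const _
  exact primrec_natPair (Primrec.const 3) (primrec_natPair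
    (primrec_natPair (Primrec.const 1) (primrec_natPair (Primrec.const 2) (primrec_natPair h0 hn)))
    (primrec_natPair (Primrec.const 4) (primrec_natPair
      (primrec_natPair (Primrec.const 1)
        (primrec_natPair (Primrec.const 0) (primrec_natPair hn h0)))
      (primrec_exsCode hK hq))))

theorem primrec_elimCode {N K s s' : α → ℕ} {l Φ Ψ : α → List ℕ} (hN : Primrec N)
    (hK : Primrec K) (hs : Primrec s) (hs' : Primrec s') (hl : Primrec l) (hΦ : Primrec Φ)
    (hΨ : Primrec Ψ) :
    Primrec fun a => elimCode (N a) (K a) (s a) (s' a) (l a) (Φ a) (Ψ a) := by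
  refine primrec_disjCode (Primrec.list_map hΦ ?_)
  refine primrec_disjCode (Primrec.list_map (hΨ.comp Primrec.fst) ?_)
  -- the last argument is `((a, φ), ψ)`
  have ha := Primrec.fst.comp (Primrec.fst (α := α × ℕ) (β := ℕ))
  have hm := primrec_numColours (hl.comp ha)
  refine primrec_exsCode hm (primrec_natPair (Primrec.const 3) (primrec_natPair
    (primrec_natPair (Primrec.const 1) (primrec_natPair (Primrec.const 0) (primrec_natPair
      (primrec_sumTermCode ((hs.pair hl).comp ha) (Primrec.const _))
      (primrec_natPair (Primrec.const 1) (primrec_natPair (Primrec.const 0) (hN.comp ha))))))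
    (primrec_conjCode (Primrec.list_map (Primrec.list_range.comp hm) ?_))))
  -- the last argument is `(((a, φ), ψ), t)`
  have hp := Primrec.fst (α := (α × ℕ) × ℕ) (β := ℕ)
  exact primrec_colourCode (hK.comp (ha.comp hp)) Primrec.snd (primrec_natPair (Primrec.const 3)
    (primrec_natPair
      (primrec_matrixTransCode ((hs.pair hl).comp (ha.comp hp)) Primrec.snd
        (Primrec.snd.comp (Primrec.fst.comp hp)))
      (primrec_matrixTransCode ((hs'.pair hl).comp (ha.comp hp)) Primrec.snd
        (Primrec.snd.comp hp))))

end Primrec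


/-! ### Correctness of the elimination on Gödel numbers -/

section Codes

variable {p : ℕ} {X : Type} [Encodable X] {n : ℕ}

theorem code_conj (l : List (ArithForm p X n)) :
    (ArithForm.conj l).code = conjCode (l.map ArithForm.code) := by
  induction l with
  | nil => rfl
  | cons φ l ih => exact congrArg (fun r => Nat.pair 3 (Nat.pair φ.code r)) ih

theorem code_disj (l : List (ArithForm p X n)) :
    (ArithForm.disj l).code = disjCode (l.map ArithForm.code) := by
  induction l with
  | nil => rfl
  | cons φ l ih => exact congrArg (fun r => Nat.pair 4 (Nat.pair φ.code r)) ih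

theorem code_exs (k : ℕ) (φ : ArithForm p X (n + k)) :
    (ArithForm.exs k φ).code = exsCode k φ.code := by
  induction k with
  | zero => rfl
  | succ k ih =>
    rw [ArithForm.exs, ih]
    rfl

end Codes

namespace Scheme

variable {σ : Sig} {X A B : Type} [Encodable X] [Encodable A] [Encodable B]
  {srt : B → Fin σ.numData} {X' : Type} [Encodable X'] {K s : ℕ} {l : List ℕ}

/-- The scheme multiplies the numbers of variables by `s`, and its colours are given by `digit`. -/
structure Coded (F : Scheme σ X A srt X' (numColours l) K) (s : ℕ) : Prop where
  intVar : ∀ x, Encodable.encode (F.intVar x) = s * Encodable.encode x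
  slot : ∀ a, (F.slot a : ℕ) = s * Encodable.encode a
  val : ∀ t b, (F.val t b : ℕ) = digit l t (s * Encodable.encode b)

variable {F : Scheme σ X A srt X' (numColours l) K}

theorem Coded.dataAtomTest_eq (hF : F.Coded s) (t : Fin (numColours l)) (d : DataAtom σ srt) :
    dataAtomTest (s, l) t d.code = true ↔ d.Holds (F.val t) := by
  cases d <;> simp [dataAtomTest, DataAtom.code, DataAtom.Holds, hF.val, Fin.ext_iff]

theorem Coded.dataTest_eq (hF : F.Coded s) (t : Fin (numColours l)) (ψ : DataForm σ srt) :
    dataTest (s, l) t (ψ.code DataAtom.code) = true ↔ ψ.Holds fun d => d.Holds (F.val t) := by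
  unfold dataTest
  induction ψ with
  | tt => simp [BoolComb.code, BoolComb.Holds, codeFold_leaf]
  | ff => simp [BoolComb.code, BoolComb.Holds, codeFold_leaf]
  | atom d => simp [BoolComb.code, BoolComb.Holds, codeFold_leaf, hF.dataAtomTest_eq]
  | neg φ ih => simp [BoolComb.code, BoolComb.Holds, codeFold_node, ← ih]
  | and φ ψ ih ih' => simp [BoolComb.code, BoolComb.Holds, codeFold_node, ← ih, ← ih']
  | or φ ψ ih ih' => simp [BoolComb.code, BoolComb.Holds, codeFold_node, ← ih, ← ih']

theorem code_sumTerm {p n q : ℕ} (idx : Fin (numColours l) → Fin n)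
    (P : Fin (numColours l) → Prop) (hidx : ∀ t, (idx t : ℕ) = t)
    (hP : ∀ t : Fin (numColours l), dataTest (s, l) t q = true ↔ P t) :
    (sumTerm idx P : LinTerm (ArithSym p X' n)).code ArithSym.code = sumTermCode (s, l) q := by
  rw [sumTerm, sumTermCode, ← List.map_coe_finRange_eq_range, List.foldr_map]
  induction List.finRange (numColours l) with
  | nil => rfl
  | cons t ts ih =>
    rw [List.foldr_cons, List.foldr_cons, ← ih]
    by_cases h : P t
    · simp [h, (hP t).2 h, LinTerm.code, ArithSym.code, hidx]
    · simp [h, mt (hP t).1 h]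

theorem Coded.code_basicTerm (hF : F.Coded s) (u : ExtTerm σ X A srt) :
    (F.basicTerm u).code ArithSym.code = basicTermCode (s, l) u.code := by
  cases u with
  | card ψ =>
    simp only [basicTerm, basicTermCode, ExtTerm.code, Nat.unpair_pair]
    exact code_sumTerm _ _ (by simp) fun t => hF.dataTest_eq t ψ
  | _ => simp [basicTerm, basicTermCode, ExtTerm.code, LinTerm.code, ArithSym.code, hF.intVar,
      hF.slot]

theorem Coded.code_term (hF : F.Coded s) (u : LinTerm (ExtTerm σ X A srt)) :
    (u.bind F.basicTerm).code ArithSym.code = termCode (s, l) (u.code ExtTerm.code) := by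
  unfold termCode
  induction u with
  | num c => simp [LinTerm.bind, LinTerm.code, codeFold_leaf]
  | basic u => simp [LinTerm.bind, LinTerm.code, codeFold_leaf, hF.code_basicTerm]
  | add u v ih ih' => simp [LinTerm.bind, LinTerm.code, codeFold_node, ih, ih']
  | sub u v ih ih' => simp [LinTerm.bind, LinTerm.code, codeFold_node, ih, ih']

theorem Coded.code_atom (hF : F.Coded s) (a : ArithAtom (ExtTerm σ X A srt)) :
    (a.bind F.basicTerm).code ArithSym.code = atomCode (s, l) (a.code ExtTerm.code) := by
  cases a <;> simp [ArithAtom.bind, ArithAtom.code, atomCode, hF.code_term]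

theorem Coded.code_matrix (hF : F.Coded s) (t : Fin (numColours l)) (φ : Matrix₁ σ X A srt) :
    (F.matrix t φ).code = matrixTransCode (s, l) t (matrixCode φ) := by
  unfold matrixTransCode matrixCode
  induction φ with
  | tt => simp [matrix, ArithForm.code, BoolComb.code, codeFold_leaf]
  | ff => simp [matrix, ArithForm.code, BoolComb.code, codeFold_leaf]
  | atom a =>
    rcases a with d | a
    · by_cases h : d.Holds (F.val t)
      · simp [matrix, ArithForm.code, BoolComb.code, codeFold_leaf, h,
          (hF.dataAtomTest_eq t d).2 h]
      · simp [matrix, ArithForm.code, BoolComb.code, codeFold_leaf, h,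
          mt (hF.dataAtomTest_eq t d).1 h]
    · simp [matrix, ArithForm.code, BoolComb.code, codeFold_leaf, hF.code_atom]
  | neg φ ih => simp [matrix, ArithForm.code, BoolComb.code, codeFold_node, ih]
  | and φ ψ ih ih' => simp [matrix, ArithForm.code, BoolComb.code, codeFold_node, ih, ih']
  | or φ ψ ih ih' => simp [matrix, ArithForm.code, BoolComb.code, codeFold_node, ih, ih']

theorem dataTest_tt (e : ℕ × List ℕ) (t : ℕ) : dataTest e t (Nat.pair 0 0) = true := by
  simp [dataTest, codeFold_leaf]

variable {Y C D : Type} [Encodable Y] [Encodable C] [Encodable D] {srt' : D → Fin σ.numData}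
  {G : Scheme σ Y C srt' X' (numColours l) K} {s' : ℕ}

theorem Coded.code_elim (hF : F.Coded s) (hG : G.Coded s') (Φ : UForm σ X A srt)
    (Ψ : UForm σ Y C srt') :
    (elim F G Φ Ψ).code =
      elimCode σ.N K s s' l (Φ.map matrixCode) (Ψ.map matrixCode) := by
  have h (φ : Matrix₁ σ X A srt) (ψ : Matrix₁ σ Y C srt') :
      (someColouring σ X' (numColours l) K fun t => .and (F.matrix t φ) (G.matrix t ψ)).code =
      exsCode (numColours l) (Nat.pair 3 (Nat.pair
      (Nat.pair 1 (Nat.pair 0 (Nat.pair (sumTermCode (s, l) (Nat.pair 0 0))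
        (Nat.pair 1 (Nat.pair 0 σ.N)))))
      (conjCode ((List.range (numColours l)).map fun t => colourCode K t (Nat.pair 3 (Nat.pair
        (matrixTransCode (s, l) t (matrixCode φ))
        (matrixTransCode (s', l) t (matrixCode ψ)))))))) := by
    have hsum := code_sumTerm (X' := X') (p := σ.numPar) (s := s) (countVar (m := numColours l))
      (fun _ => True) (by simp) fun t => iff_true_intro (dataTest_tt (s, l) t)
    rw [← List.map_coe_finRange_eq_range, List.map_map]
    simp only [someColouring, code_exs, ArithForm.code, code_conj, List.map_map, ArithAtom.code,
      LinTerm.code, ArithSym.code, hsum, Function.comp_def, hF.code_matrix, hG.code_matrix,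
      Fin.val_natAdd, zero_add, colourCode]
  simp only [elim, code_disj, List.map_map, elimCode, Function.comp_def, h]

/-- The scheme whose colours are the numbers with digits for the array-ids, where `l` lists the
largest values of the array-ids. -/
def ofDigits (l : List ℕ) (s : ℕ) (hl : ∀ b, l.getD (s * Encodable.encode b) 0 = σ.top (srt b))
    (intVar : X → X') (slot : A → Fin K) : Scheme σ X A srt X' (numColours l) K where
  intVar := intVar
  slot := slot
  val t b := ⟨digit l t (s * Encodable.encode b), hl b ▸ digit_lt _ _ _⟩

end Scheme


namespace Scheme

variable {σ : Sig} {X A B : Type} [Encodable B] {srt : B → Fin σ.numData} {X' : Type} {K s : ℕ}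
  {l : List ℕ}

theorem exists_val_ofDigits_eq (hs : 0 < s) (hlen : ∀ b : B, s * Encodable.encode b < l.length)
    (hl : ∀ b, l.getD (s * Encodable.encode b) 0 = σ.top (srt b)) (intVar : X → X')
    (slot : A → Fin K) (v : (b : B) → σ.Val (srt b)) :
    ∃ t, (ofDigits l s hl intVar slot).val t = v := by
  have hinj : Function.Injective fun b : B => s * Encodable.encode b := fun b b' h =>
    Encodable.encode_injective (Nat.eq_of_mul_eq_mul_left hs h)
  obtain ⟨t, ht⟩ := exists_digit_eq l
    (Function.extend (fun b : B => s * Encodable.encode b) (fun b => (v b : ℕ)) 0) fun c _ => by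
      by_cases h : ∃ b : B, s * Encodable.encode b = c
      · obtain ⟨b, rfl⟩ := h
        rw [hinj.extend_apply, hl]
        exact Nat.le_of_lt_succ (v b).2
      · rw [Function.extend_apply' _ _ _ h]
        exact Nat.zero_le _
  exact ⟨t, funext fun b => Fin.ext ((ht _ (hlen b)).trans (hinj.extend_apply _ _ b))⟩

/-- Every interpretation is described by a colouring of the processes and tuples of integers. -/
theorem exists_interp_ofDigits_eq (hs : 0 < s)
    (hlen : ∀ b : B, s * Encodable.encode b < l.length)
    (hl : ∀ b, l.getD (s * Encodable.encode b) 0 = σ.top (srt b)) {slot : A → Fin K}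
    (hslot : Function.Injective slot) {M : Model σ} (I : Interp M X A srt) :
    ∃ c z, (ofDigits l s hl id slot).interp I.int c z = I := by
  choose c hc using fun i => exists_val_ofDigits_eq hs hlen hl (id : X → X) slot
    fun b => I.enum b i
  refine ⟨c, fun i => Function.extend slot (fun a => I.arr a i) 0, ?_⟩
  have h₁ : (fun a i => Function.extend slot (fun a => I.arr a i) 0 (slot a)) = I.arr :=
    funext fun a => funext fun i => hslot.extend_apply _ _ a
  have h₂ : (fun b i => (ofDigits l s hl (id : X → X) slot).val (c i) b) = I.enum :=
    funext fun b => funext fun i => congrFun (hc i) b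
  simp only [interp, h₂]
  simp only [ofDigits, h₁, id]

theorem coded_ofDigits [Encodable X] [Encodable A] [Encodable X']
    (hl : ∀ b, l.getD (s * Encodable.encode b) 0 = σ.top (srt b))
    {intVar : X → X'} {slot : A → Fin K}
    (hX : ∀ x, Encodable.encode (intVar x) = s * Encodable.encode x)
    (hA : ∀ a, (slot a : ℕ) = s * Encodable.encode a) :
    (ofDigits l s hl intVar slot).Coded s :=
  ⟨hX, hA, fun _ _ => rfl⟩

end Scheme

/-! ### The counter abstraction of a specification -/

/-- Each entry of a list twice. If the entries belong to the array-ids `b`, those of the new list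
belong to the array-ids `Sum.inl b` and `Sum.inr b`, in the order of their Gödel numbers. -/
def double (l : List ℕ) : List ℕ := l.flatMap fun a => [a, a]

theorem length_double (l : List ℕ) : (double l).length = 2 * l.length := by
  induction l with
  | nil => rfl
  | cons a l ih => simp_all [double]; ring

theorem getD_double (l : List ℕ) (c : ℕ) :
    (double l).getD (2 * c) 0 = l.getD c 0 ∧ (double l).getD (2 * c + 1) 0 = l.getD c 0 := by
  induction l generalizing c with
  | nil => simp [double]
  | cons a l ih =>
    cases c with
    | zero => simp [double]
    | succ c => simpa [double, Nat.mul_add] using ih c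

theorem primrec_double : Primrec double :=
  Primrec.list_flatMap Primrec.id (Primrec.list_cons.comp Primrec.snd
    (Primrec.list_cons.comp Primrec.snd (Primrec.const []))).to₂

namespace Spec

variable {σ : Sig} (S : Spec σ)

/-- The largest values of the enumerated array-ids. -/
def tops : List ℕ := List.ofFn fun b => σ.top (S.srt b)

theorem length_tops : S.tops.length = S.numEnum := List.length_ofFn

theorem getD_tops (b : Fin S.numEnum) : S.tops.getD b 0 = σ.top (S.srt b) := by
  simp [tops]

theorem encode_fin {n : ℕ} (b : Fin n) : Encodable.encode b = (b : ℕ) := rfl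

theorem getD_one_mul_tops (b : Fin S.numEnum) :
    S.tops.getD (1 * Encodable.encode b) 0 = σ.top (S.srt b) := by
  rw [one_mul, encode_fin, getD_tops]

theorem getD_two_mul_double_tops (b : Fin S.numEnum) :
    (double S.tops).getD (2 * Encodable.encode b) 0 = σ.top (S.srt b) := by
  rw [(getD_double _ _).1, encode_fin, getD_tops]

theorem getD_one_mul_double_tops (b : Fin S.numEnum ⊕ Fin S.numEnum) :
    (double S.tops).getD (1 * Encodable.encode b) 0 = σ.top (Sum.elim S.srt S.srt b) := by
  rcases b with b | b
  · rw [one_mul, Encodable.encode_inl, (getD_double _ _).1, encode_fin, getD_tops, Sum.elim_inl]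
  · rw [one_mul, Encodable.encode_inr, (getD_double _ _).2, encode_fin, getD_tops, Sum.elim_inr]

/-- The scheme for one copy of the variables. -/
def scheme : Scheme σ (Fin S.numInt) (Fin S.numArr) S.srt (Fin S.numInt)
    (numColours S.tops) S.numArr :=
  .ofDigits S.tops 1 S.getD_one_mul_tops id id

/-- The slots for two copies of the arithmetic array-ids. -/
def pairSlot : Fin S.numArr ⊕ Fin S.numArr → Fin (2 * S.numArr) :=
  Sum.elim (fun a => ⟨2 * a, by omega⟩) fun a => ⟨2 * a + 1, by omega⟩

/-- The scheme for the variables and their primed copies. -/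
def pairScheme : Scheme σ (Fin S.numInt ⊕ Fin S.numInt) (Fin S.numArr ⊕ Fin S.numArr)
    (Sum.elim S.srt S.srt) (Fin S.numInt ⊕ Fin S.numInt) (numColours (double S.tops))
    (2 * S.numArr) :=
  .ofDigits (double S.tops) 1 S.getD_one_mul_double_tops id S.pairSlot

/-- The restriction of `pairScheme` to the unprimed variables. -/
def leftScheme : Scheme σ (Fin S.numInt) (Fin S.numArr) S.srt (Fin S.numInt ⊕ Fin S.numInt)
    (numColours (double S.tops)) (2 * S.numArr) :=
  .ofDigits (double S.tops) 2 S.getD_two_mul_double_tops Sum.inl fun a => S.pairSlot (.inl a)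

theorem coded_scheme : S.scheme.Coded 1 :=
  Scheme.coded_ofDigits _ (by simp) (by simp [encode_fin])

theorem coded_pairScheme : S.pairScheme.Coded 1 :=
  Scheme.coded_ofDigits _ (by simp) (by
    rintro (a | a)
    · simp [pairSlot, encode_fin]
    · simp [pairSlot, encode_fin])

theorem coded_leftScheme : S.leftScheme.Coded 2 :=
  Scheme.coded_ofDigits _ (by simp) (by simp [pairSlot, encode_fin])

theorem exists_interp_scheme_eq {M : Model σ} (I : S.Int M) :
    ∃ c z, S.scheme.interp I.int c z = I :=
  Scheme.exists_interp_ofDigits_eq one_pos (by simp [encode_fin, length_tops]) _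
    Function.injective_id I

theorem injective_pairSlot : Function.Injective S.pairSlot := by
  rintro (a | a) (b | b) h <;> simp [pairSlot] at h <;> first | omega | (congr 1; omega)

theorem exists_interp_pairScheme_eq {M : Model σ} (I I' : S.Int M) :
    ∃ c z, S.pairScheme.interp (Sum.elim I.int I'.int) c z = I.pair I' := by
  refine Scheme.exists_interp_ofDigits_eq one_pos ?_ _ S.injective_pairSlot (I.pair I')
  rintro (b | b)
  · simp only [Encodable.encode_inl, encode_fin, length_double, length_tops]
    omega
  · simp only [Encodable.encode_inr, encode_fin, length_double, length_tops]
    omega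

theorem interp_pairScheme {M : Model σ} (x x' : Fin S.numInt → ℤ)
    (c : M.Proc → Fin (numColours (double S.tops))) (z : M.Proc → Fin (2 * S.numArr) → ℤ) :
    ∃ I' : S.Int M, I'.int = x' ∧ S.pairScheme.interp (Sum.elim x x') c z =
      (S.leftScheme.interp (Sum.elim x x') c z).pair I' := by
  refine ⟨⟨x', fun a i => z i (S.pairSlot (.inr a)), fun b i => S.pairScheme.val (c i) (.inr b)⟩,
    rfl, ?_⟩
  unfold Scheme.interp Interp.pair
  congr 1
  · funext a
    rcases a with a | a <;> rfl
  · funext b i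
    rcases b with b | b
    · exact Fin.ext (by simp [pairScheme, leftScheme, Scheme.ofDigits])
    · rfl

theorem pair_left_injective {M : Model σ} {I I' J J' : S.Int M} (h : I.pair I' = J.pair J') :
    I = J := by
  rcases I with ⟨x, a, e⟩
  rcases J with ⟨y, b, d⟩
  have h₁ := congrArg Interp.int h
  have h₂ := congrArg Interp.arr h
  have h₃ := congrArg Interp.enum h
  congr 1
  · exact funext fun i => congrFun h₁ (.inl i)
  · exact funext fun i => congrFun h₂ (.inl i)
  · exact funext fun i => congrFun h₃ (.inl i)

/-- The formula `∃ v₁, Φ`. -/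
noncomputable def project (Φ : UForm σ (Fin S.numInt) (Fin S.numArr) S.srt) :
    ArithForm σ.numPar (Fin S.numInt) 0 :=
  S.scheme.elim S.scheme Φ [.tt]

/-- The formula `∃ v₁ v₁', Φ ∧ τ`, for the invariant `Φ` and the transition formula `τ`. -/
noncomputable def projectTrans : ArithForm σ.numPar (Fin S.numInt ⊕ Fin S.numInt) 0 :=
  S.leftScheme.elim S.pairScheme S.inv S.trans

theorem sat_project (Φ : UForm σ (Fin S.numInt) (Fin S.numArr) S.srt) (M : Model σ)
    (x : Fin S.numInt → ℤ) :
    (S.project Φ).Sat M.par x ↔ ∃ I : S.Int M, I.int = x ∧ I.Sat Φ := by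
  rw [project, Scheme.sat_elim]
  constructor
  · rintro ⟨c, z, h, -⟩
    exact ⟨_, rfl, h⟩
  · rintro ⟨I, rfl, h⟩
    obtain ⟨c, z, hI⟩ := S.exists_interp_scheme_eq I
    exact ⟨c, z, by rwa [hI], .tt, by simp, fun _ => trivial⟩

theorem sat_projectTrans (M : Model σ) (x x' : Fin S.numInt → ℤ) :
    S.projectTrans.Sat M.par (Sum.elim x x') ↔ ∃ I I' : S.Int M, I.int = x ∧ I'.int = x' ∧
      I.Sat S.inv ∧ (I.pair I').Sat S.trans := by
  rw [projectTrans, Scheme.sat_elim]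
  constructor
  · rintro ⟨c, z, h, h'⟩
    obtain ⟨I', hx', hI'⟩ := S.interp_pairScheme x x' c z
    exact ⟨_, I', rfl, hx', h, hI' ▸ h'⟩
  · rintro ⟨I, I', rfl, rfl, h, h'⟩
    obtain ⟨c, z, hI⟩ := S.exists_interp_pairScheme_eq I I'
    obtain ⟨J', -, hJ⟩ := S.interp_pairScheme I.int I'.int c z
    have := S.pair_left_injective (hJ.symm.trans hI)
    exact ⟨c, z, by rwa [this], by rwa [hI]⟩

/-- The counter abstraction given by the projections of the three formulas. -/
noncomputable def counterSpec : CounterSpec σ S.numInt S.AP where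
  inv := S.project S.inv
  init := S.project S.init
  trans := S.projectTrans
  init_inv := by
    rintro ⟨_, M, rfl⟩ x h
    obtain ⟨I, hx, hI⟩ := (S.sat_project _ M x).1 h
    exact (S.sat_project _ M x).2 ⟨I, hx, S.init_inv M I hI⟩
  trans_inv := by
    rintro ⟨_, M, rfl⟩ x x' - h
    obtain ⟨I, I', -, hx', hI, hI'⟩ := (S.sat_projectTrans M x x').1 h
    exact (S.sat_project _ M x').2 ⟨I', hx', S.trans_inv M I I' hI hI'⟩

theorem isCounterAbstraction_counterSpec : IsCounterAbstraction S S.counterSpec where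
  inv M I h := (S.sat_project _ M _).2 ⟨I, rfl, h⟩
  init M I h := (S.sat_project _ M _).2 ⟨I, rfl, h⟩
  trans M I I' h h' := (S.sat_projectTrans M _ _).2 ⟨I, I', rfl, rfl, h, h'⟩

theorem isStrongest_counterSpec : IsStrongestCounterAbstraction S S.counterSpec := by
  refine ⟨S.isCounterAbstraction_counterSpec, fun C hC => ?_⟩
  have hW : S.counterSpec.ts.W ⊆ C.ts.W := by
    rintro ⟨⟨_, M, rfl⟩, x⟩ h
    obtain ⟨I, rfl, hI⟩ := (S.sat_project _ M x).1 h
    exact hC.inv M I hI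
  refine ⟨hW, ⟨?_, ?_, ?_, ?_, ?_⟩⟩
  · rintro w _ ⟨hw, rfl⟩
    exact ⟨hw, hW hw⟩
  · exact fun w hw => ⟨w, hW hw, hw, rfl⟩
  · rintro ⟨⟨_, M, rfl⟩, x⟩ _ ⟨-, rfl⟩ h
    obtain ⟨I, rfl, hI⟩ := (S.sat_project _ M x).1 h
    exact hC.init M I hI
  · rintro ⟨⟨_, M, rfl⟩, x⟩ _ ⟨_, x'⟩ ⟨-, rfl⟩ ⟨rfl, hx, hx', h⟩
    refine ⟨_, hW hx', ⟨rfl, hW hx, hW hx', ?_⟩, hx', rfl⟩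
    obtain ⟨I, I', rfl, rfl, hI, hI'⟩ := (S.sat_projectTrans M x x').1 h
    exact hC.trans M I I' hI hI'
  · rintro w _ ⟨-, rfl⟩
    rfl

theorem isSimulation_projection : IsSimulation S.ts S.counterSpec.ts
    (projection S S.counterSpec) := by
  have hC := S.isCounterAbstraction_counterSpec
  refine ⟨fun w w' h => ⟨h.1, h.2.1⟩, ?_, ?_, ?_, ?_⟩
  · rintro ⟨M, I⟩ h
    exact ⟨_, hC.inv M I h, h, hC.inv M I h, rfl⟩
  · rintro ⟨M, I⟩ _ ⟨-, -, rfl⟩ h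
    exact hC.init M I h
  · rintro _ _ _ ⟨-, -, rfl⟩ ⟨M, I, I', rfl, rfl, h, h', ht⟩
    exact ⟨(M.restrict, I'.int), hC.inv M I' h', ⟨rfl, hC.inv M I h, hC.inv M I' h',
      hC.trans M I I' h ht⟩, h', hC.inv M I' h', rfl⟩
  · rintro ⟨M, I⟩ _ ⟨-, -, rfl⟩
    rfl

end Spec

/-! ### The algorithm -/

/-- The list of numbers with a given Gödel number. -/
def decodeList (n : ℕ) : List ℕ := (Encodable.decode (α := List ℕ) n).getD []

theorem decodeList_encode (l : List ℕ) : decodeList (Encodable.encode l) = l := by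
  simp [decodeList]

theorem primrec_decodeList : Primrec decodeList :=
  Primrec.option_getD.comp Primrec.decode (Primrec.const [])

/-- The function computing the Gödel number of the counter abstraction from that of the
specification, given as a tuple of numbers: `N`, the largest values of the enumerated sorts,
`numArr`, the sorts of the enumerated array-ids, and the three formulas. -/
def abstractionCode (N : ℕ) (top : List ℕ) (numArr : ℕ) (srt inv init trans : List ℕ) : ℕ :=
  Nat.pair (elimCode N numArr 1 1 (srt.map fun d => top.getD d 0) inv [Nat.pair 0 0])
    (Nat.pair (elimCode N numArr 1 1 (srt.map fun d => top.getD d 0) init [Nat.pair 0 0])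
      (elimCode N (2 * numArr) 2 1 (double (srt.map fun d => top.getD d 0)) inv trans))

theorem primrec_abstractionCode {α : Type} [Primcodable α] {N numArr : α → ℕ}
    {top srt inv init trans : α → List ℕ} (hN : Primrec N) (htop : Primrec top)
    (hA : Primrec numArr) (hsrt : Primrec srt) (hinv : Primrec inv) (hinit : Primrec init)
    (htrans : Primrec trans) :
    Primrec fun a => abstractionCode (N a) (top a) (numArr a) (srt a) (inv a) (init a)
      (trans a) := by
  have hl : Primrec fun a => (srt a).map fun d => (top a).getD d 0 :=
    Primrec.list_map hsrt ((Primrec.list_getD 0).comp (htop.comp Primrec.fst) Primrec.snd).to₂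
  have h1 : Primrec fun _ : α => 1 := Primrec.const 1
  have h2 : Primrec fun _ : α => 2 := Primrec.const 2
  have ht : Primrec fun _ : α => [Nat.pair 0 0] := Primrec.const _
  exact primrec_natPair (primrec_elimCode hN hA h1 h1 hl hinv ht)
    (primrec_natPair (primrec_elimCode hN hA h1 h1 hl hinit ht)
      (primrec_elimCode hN (Primrec.nat_mul.comp h2 hA) h2 h1 (primrec_double.comp hl) hinv
        htrans))

/-- The algorithm on Gödel numbers of specifications. The numbers of tuples are iterated pairs,
whose components `numPar`, `numInt` and `emptyProc` are not needed. -/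
def algorithm (n : ℕ) : ℕ :=
  abstractionCode n.unpair.1.unpair.2.unpair.1
    (decodeList n.unpair.1.unpair.2.unpair.2.unpair.1)
    n.unpair.2.unpair.2.unpair.1
    (decodeList n.unpair.2.unpair.2.unpair.2.unpair.1)
    (decodeList n.unpair.2.unpair.2.unpair.2.unpair.2.unpair.1)
    (decodeList n.unpair.2.unpair.2.unpair.2.unpair.2.unpair.2.unpair.1)
    (decodeList n.unpair.2.unpair.2.unpair.2.unpair.2.unpair.2.unpair.2)

theorem primrec_algorithm : Primrec algorithm := by
  have hσ := primrec_right (primrec_left Primrec.id)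
  have h₂ := primrec_right (primrec_right Primrec.id)
  have h₃ := primrec_right h₂
  have h₄ := primrec_right h₃
  have h₅ := primrec_right h₄
  exact primrec_abstractionCode (primrec_left hσ)
    (primrec_decodeList.comp (primrec_left (primrec_right hσ))) (primrec_left h₂)
    (primrec_decodeList.comp (primrec_left h₃)) (primrec_decodeList.comp (primrec_left h₄))
    (primrec_decodeList.comp (primrec_left h₅)) (primrec_decodeList.comp (primrec_right h₅))

theorem algorithm_code {σ : Sig} (S : Spec σ) : algorithm S.code = S.counterSpec.code := by
  have htops : (List.ofFn fun b => (S.srt b : ℕ)).map (fun d => (List.ofFn σ.top).getD d 0) =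
      S.tops := by
    simp [Spec.tops, List.map_ofFn, Function.comp_def]
  have h (Φ : UForm σ (Fin S.numInt) (Fin S.numArr) S.srt) : (S.project Φ).code =
      elimCode σ.N S.numArr 1 1 S.tops (Φ.map matrixCode) [Nat.pair 0 0] :=
    S.coded_scheme.code_elim S.coded_scheme Φ [.tt]
  have h' : S.projectTrans.code = elimCode σ.N (2 * S.numArr) 2 1 (double S.tops)
      (S.inv.map matrixCode) (S.trans.map matrixCode) :=
    S.coded_leftScheme.code_elim S.coded_pairScheme S.inv S.trans
  simp only [algorithm, Spec.code, Sig.code, uformCode, Encodable.encode_prod_val,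
    Encodable.encode_nat, Nat.unpair_pair, decodeList_encode, abstractionCode, htops,
    CounterSpec.code, Spec.counterSpec, h, h']

end CounterAbs

open CounterAbs
theorem theorem1 :
    ∃ f : ℕ → ℕ, Computable f ∧
      ∀ (σ : Sig) (S : Spec σ), ∃ C : CounterSpec σ S.numInt S.AP,
        f S.code = C.code ∧
        IsStrongestCounterAbstraction S C ∧
        IsSimulation S.ts C.ts (projection S C) ∧
        (∀ (M : Model σ) (x : Fin S.numInt → ℤ),
          C.inv.Sat M.par x ↔ ∃ I : S.Int M, I.int = x ∧ I.Sat S.inv) ∧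
        (∀ (M : Model σ) (x : Fin S.numInt → ℤ),
          C.init.Sat M.par x ↔ ∃ I : S.Int M, I.int = x ∧ I.Sat S.init) ∧
        (∀ (M : Model σ) (x x' : Fin S.numInt → ℤ),
          C.trans.Sat M.par (Sum.elim x x') ↔
            ∃ I I' : S.Int M, I.int = x ∧ I'.int = x' ∧
              I.Sat S.inv ∧ (I.pair I').Sat S.trans) :=
  ⟨algorithm, primrec_algorithm.to_comp, fun _ S => ⟨S.counterSpec, algorithm_code S,
    S.isStrongest_counterSpec, S.isSimulation_projection, S.sat_project S.inv,
    S.sat_project S.init, S.sat_projectTrans⟩⟩
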